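/- Let $\Bbbk$ be an algebraically closed field and let $A$ be a nonzero basic connected finite-dimensional $\Bbbk$-algebra with a fixed complete set $A_0$ of orthogonal primitive idempotents, regarded as a finite locally bounded $\Bbbk$-category with object set $A_0$ and $A(x,y)=yAx$. Assume that $A$ has no nonzero oriented cycles, i.e. $A(x,x)\cong\Bbbk$ for all $x\in A_0$. Write $A\cong\Bbbk Q/I$ with a quiver $Q$ ($Q_0=A_0$) and an admissible ideal $I$, and let $\overline{\alpha}$ be the morphism of $A$ given by an arrow $\alpha$. The repetitive category $\hat A$ has objects $x^{[i]}$ ($x\in A_0$, $i\in\mathbb Z$); $\hat A(x^{[i]},y^{[j]})$ is $A(x,y)$ if $j=i$, is $DA(y,x)=\operatorname{Hom}_{\Bbbk}(A(y,x),\Bbbk)$ if $j=i+1$, and is $0$ otherwise; composition is given by the composition of $A$ and the $A$-bimodule structure of $DA$, the product of two elements of $DA$ being $0$. Let $A^{[i]}$ be the full subcategory on the objects $x^{[i]}$, $x\in A_0$, let $\mathrm{id}^{[0]}\colon A\to A^{[0]}$ be the canonical isomorphism, and let $\nu_A$ be the Nakayama automorphism, which raises all indices by $1$. An automorphism $\phi$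 of $\hat A$ has jump $n\in\mathbb Z$ if $\phi(A^{[0]})=A^{[n]}$; then $\phi_0:=(\mathrm{id}^{[0]})^{-1}\,\phi\,\nu_A^{-n}\,\mathrm{id}^{[0]}$ is an automorphism of $A$. For an automorphism $\phi$ of $\hat A$, the orbit category $\hat A/\langle\phi\rangle$ of the $\mathbb Z$-action $a\mapsto\phi^a$ has the objects of $\hat A$ and morphism spaces $\bigoplus_{a\in\mathbb Z}\hat A(\phi^a u,v)$; the composite of $f\colon\phi^a u\to v$ and $g\colon\phi^b v\to w$ is $g\,\phi^b(f)$, and $\hat A(\phi^a u,v)$ is the part of degree $a$. When $n\neq0$ the action is free, and the orbit category may also be taken to have one object for each orbit, i.e. to be the full subcategory on a set of representatives of the orbits of objects. A natural isomorphism $\eta\colon\psi\Rightarrow\phi$ making $(\mathrm{id}_{\hat A},\eta)$ a $\mathbb Z$-equivariant functor means a family of natural isomorphisms $\eta_a\colon\psi^a\Rightarrow\phi^a$ ($a\in\mathbb Z$, $\eta_1=\eta$) with $\eta_{b+a}=(\eta_b\phi^a)(\psi^b\eta_a)$; then $(\mathrm{id}_{\hat A},\eta)/\mathbb Z\colon\hat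 A/\langle\phi\rangle\to\hat A/\langle\psi\rangle$ is the functor that is the identity on objects and sends $f\colon\phi^a u\to v$ of degree $a$ to $f\,\eta_{a,u}\colon\psi^a u\to v$ of degree $a$. Let $\mathbb Z\text{-}\mathbf{GrCat}$ be the 2-category of $\mathbb Z$-graded $\Bbbk$-categories. Its 1-morphisms are the degree-preserving functors $(H,r)\colon\mathcal B\to\mathcal B'$, i.e. $\Bbbk$-linear functors $H$ with a map $r\colon\mathcal B_0\to\mathbb Z$ such that $H$ maps morphisms $x\to y$ of degree $r_y+a$ to morphisms of degree $a+r_x$; strictly degree-preserving functors are those with $r=0$. Its 2-morphisms $(H,r)\Rightarrow(I,s)$ are the natural transformations $\theta$ with $\theta_x$ homogeneous of degree $r_x-s_x$. A walk in $Q$ is a path in the double quiver of $Q$, in which every arrow $\alpha$ has a formal inverse $\alpha^{-1}$. A cycle is a closed walk $l_m\cdots l_1$ ($m\ge1$), and it is simple if the sources of $l_1,\dots,l_m$ are distinct. Simple cycles $C,C'$ are equivalent if a cyclic rotation of $C$ equals $C'$ or $C'^{-1}$. **Theorem 4.4.** Let $\phi,\psi$ be automorphisms of $\hat A$ with jump $n\in\mathbb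 Z$ that coincide on the objects of $\hat A$, and let $\mathcal S$ be a complete set of representatives of the equivalence classes of simple cycles in $Q$. Assume that 1. for each arrow $\alpha$ of $Q$ there is $c_\alpha\in\Bbbk^\times$ with $(\phi_0^{-1}\psi_0)(\overline\alpha)=c_\alpha\overline\alpha$; and 2. for each $C=l_m\cdots l_1$ in $\mathcal S$ one has $c_{l_m}\cdots c_{l_1}=1$, where $c_{\alpha^{-1}}:=c_\alpha^{-1}$. Then for some natural isomorphism $\eta\colon\psi\Rightarrow\phi$ making $(\mathrm{id}_{\hat A},\eta)$ a $\mathbb Z$-equivariant functor, the functor $(\mathrm{id}_{\hat A},\eta)/\mathbb Z\colon\hat A/\langle\phi\rangle\to\hat A/\langle\psi\rangle$, with degree adjuster $r=0$, is an equivalence in $\mathbb Z\text{-}\mathbf{GrCat}$. If $n\ne0$, it is an isomorphism of $\mathbb Z$-graded categories (strictly degree-preserving, with a strictly degree-preserving inverse), and so is its restriction to the full subcategories on any set of representatives of the orbits of objects. -/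

import Mathlib

open CategoryTheory

universe w v u v' u'

/-! ### Linear automorphisms of a linear category -/

/-- A `k`-linear automorphism of a `k`-linear category: a `k`-linear functor with a strict
inverse. -/
structure LinAut (k : Type w) [Field k] (C : Type u) [Category.{v} C] [Preadditive C]
    [Linear k C] where
  functor : C ⥤ C
  inverse : C ⥤ C
  functor_inverse : functor ⋙ inverse = 𝟭 C
  inverse_functor : inverse ⋙ functor = 𝟭 C
  additive : functor.Additive
  linear : functor.Linear k

namespace LinAut

theorem comp_cancel {C : Type u} [Category.{v} C] {F F' G G' : C ⥤ C} (h : F ⋙ F' = 𝟭 C)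
    (h' : G ⋙ G' = 𝟭 C) : (F ⋙ G) ⋙ (G' ⋙ F') = 𝟭 C := by
  change F ⋙ (G ⋙ G') ⋙ F' = 𝟭 C
  rw [h']; exact h

variable {k : Type w} [Field k] {C : Type u} [Category.{v} C] [Preadditive C] [Linear k C]

instance (g : LinAut k C) : g.functor.Additive := g.additive
instance (g : LinAut k C) : g.functor.Linear k := g.linear

theorem ext_functor {g h : LinAut k C} (e : g.functor = h.functor) : g = h := by
  have e' : g.inverse = h.inverse := by
    calc g.inverse = g.inverse ⋙ (h.functor ⋙ h.inverse) := by
          rw [h.functor_inverse]; rfl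
      _ = (g.inverse ⋙ g.functor) ⋙ h.inverse := by rw [e]; rfl
      _ = h.inverse := by rw [g.inverse_functor]; rfl
  cases g; cases h; cases e; cases e'; rfl

/-- An automorphism is in particular an equivalence of categories. -/
def toEquivalence (g : LinAut k C) : C ≌ C :=
  CategoryTheory.Equivalence.mk g.functor g.inverse (eqToIso g.functor_inverse.symm)
    (eqToIso g.inverse_functor)

instance (g : LinAut k C) : g.functor.IsEquivalence :=
  inferInstanceAs g.toEquivalence.functor.IsEquivalence

instance (g : LinAut k C) : g.inverse.IsEquivalence :=
  inferInstanceAs g.toEquivalence.inverse.IsEquivalence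

theorem functor_obj_inverse_obj (g : LinAut k C) (x : C) :
    g.functor.obj (g.inverse.obj x) = x :=
  Functor.congr_obj g.inverse_functor x

theorem inverse_obj_functor_obj (g : LinAut k C) (x : C) :
    g.inverse.obj (g.functor.obj x) = x :=
  Functor.congr_obj g.functor_inverse x

theorem functor_map_inverse_map (g : LinAut k C) {x y : C} (f : x ⟶ y) :
    g.functor.map (g.inverse.map f) =
      eqToHom (g.functor_obj_inverse_obj x) ≫ f ≫
        eqToHom (g.functor_obj_inverse_obj y).symm :=
  Functor.congr_hom g.inverse_functor f

instance (g : LinAut k C) : g.inverse.Additive where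
  map_add {x y a b} := by
    apply g.functor.map_injective
    simp [functor_map_inverse_map]

instance (g : LinAut k C) : g.inverse.Linear k where
  map_smul {x y a b} := by
    apply g.functor.map_injective
    simp [functor_map_inverse_map]

/-- Automorphisms form a group; `g * h` is "first `h`, then `g`". -/
instance : Group (LinAut k C) where
  mul g h :=
    { functor := h.functor ⋙ g.functor
      inverse := g.inverse ⋙ h.inverse
      functor_inverse := comp_cancel h.functor_inverse g.functor_inverse
      inverse_functor := comp_cancel g.inverse_functor h.inverse_functor
      additive := inferInstance
      linear := inferInstance }
  one :=
    { functor := 𝟭 C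
      inverse := 𝟭 C
      functor_inverse := rfl
      inverse_functor := rfl
      additive := inferInstance
      linear := inferInstance }
  inv g :=
    { functor := g.inverse
      inverse := g.functor
      functor_inverse := g.inverse_functor
      inverse_functor := g.functor_inverse
      additive := inferInstance
      linear := inferInstance }
  mul_assoc _ _ _ := rfl
  one_mul _ := rfl
  mul_one _ := rfl
  inv_mul_cancel g := ext_functor g.functor_inverse

theorem mul_functor (g h : LinAut k C) : (g * h).functor = h.functor ⋙ g.functor := rfl
theorem one_functor : (1 : LinAut k C).functor = 𝟭 C := rfl
theorem inv_functor (g : LinAut k C) : (g⁻¹).functor = g.inverse := rfl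

theorem zpow_zero_obj (g : LinAut k C) (x : C) : (g ^ (0 : ℤ)).functor.obj x = x := by
  rw [zpow_zero]; rfl

theorem zpow_add_functor (g : LinAut k C) (a b : ℤ) :
    (g ^ (b + a)).functor = (g ^ a).functor ⋙ (g ^ b).functor := by
  rw [zpow_add]; rfl

theorem zpow_add_obj (g : LinAut k C) (a b : ℤ) (x : C) :
    (g ^ (b + a)).functor.obj x = (g ^ b).functor.obj ((g ^ a).functor.obj x) := by
  rw [zpow_add]; rfl

end LinAut

/-! ### Algebras as finite locally bounded categories -/

/-- Locally bounded `k`-categories. -/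
structure IsLocallyBounded (k : Type w) [Field k] (A : Type u) [Category.{v} A] [Preadditive A]
    [Linear k A] : Prop where
  eq_of_iso : ∀ x y : A, Nonempty (x ≅ y) → x = y
  isLocalRing_end : ∀ x : A, IsLocalRing (End x)
  finite_hom : ∀ x y : A, Module.Finite k (x ⟶ y)
  finite_support : ∀ x : A, {y : A | Nontrivial (x ⟶ y) ∨ Nontrivial (y ⟶ x)}.Finite

/-- A (nonzero) basic connected finite-dimensional `k`-algebra with a fixed complete set of
orthogonal primitive idempotents, viewed as a `k`-category `A` whose objects are the idempotents:
a nonempty finite locally bounded category whose objects are linked by chains of nonzero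
morphisms. -/
structure IsBasicConnectedAlgebra (k : Type w) [Field k] (A : Type u) [Category.{v} A]
    [Preadditive A] [Linear k A] : Prop extends IsLocallyBounded k A where
  finite_obj : Finite A
  nonempty_obj : Nonempty A
  connected : ∀ x y : A, Relation.EqvGen (fun a b : A => Nontrivial (a ⟶ b)) x y

/-- `A` has no nonzero oriented cycles: `A(x, x) ≅ k` for every object `x`. -/
def HasNoNonzeroOrientedCycles (k : Type w) [Field k] (A : Type u) [Category.{v} A]
    [Preadditive A] [Linear k A] : Prop :=
  ∀ x : A, Nonempty (End x ≃ₐ[k] k)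

/-! ### The repetitive category -/

/-- Objects `x^[i]` of the repetitive category of `A`. -/
@[ext]
structure Repetitive (k : Type w) (A : Type u) where
  obj : A
  idx : ℤ

namespace Repetitive

variable {k : Type w} [Field k] {A : Type u} [Category.{v} A] [Preadditive A] [Linear k A]

/-- Morphisms `x^[i] ⟶ y^[j]`: pairs `(f, β)` with `f ∈ A(x, y)` and `β ∈ D A(y, x)`, where `f = 0`
unless `j = i` and `β = 0` unless `j = i + 1`. So this is `A(x, y)` if `j = i`, it is `D A(y, x)`
if `j = i + 1`, and `0` otherwise. -/
def homSubmodule (p q : Repetitive k A) :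
    Submodule k ((p.obj ⟶ q.obj) × Module.Dual k (q.obj ⟶ p.obj)) where
  carrier := {m | (q.idx ≠ p.idx → m.1 = 0) ∧ (q.idx ≠ p.idx + 1 → m.2 = 0)}
  add_mem' {a b} ha hb := by
    refine ⟨fun h => ?_, fun h => ?_⟩
    · simp [ha.1 h, hb.1 h]
    · simp [ha.2 h, hb.2 h]
  zero_mem' := ⟨fun _ => rfl, fun _ => rfl⟩
  smul_mem' c a ha := by
    refine ⟨fun h => ?_, fun h => ?_⟩
    · simp [ha.1 h]
    · simp [ha.2 h]

/-- Right action `D A(z, y) × A(x, y) → D A(z, x)`, `(γ f)(h) = γ (f h)`. -/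
def dualRight {x y z : A} (f : x ⟶ y) (γ : Module.Dual k (z ⟶ y)) : Module.Dual k (z ⟶ x) :=
  γ ∘ₗ Linear.rightComp k z f

/-- Left action `A(y, z) × D A(y, x) → D A(z, x)`, `(g β)(h) = β (h g)`. -/
def dualLeft {x y z : A} (β : Module.Dual k (y ⟶ x)) (g : y ⟶ z) : Module.Dual k (z ⟶ x) :=
  β ∘ₗ Linear.leftComp k x g

@[simp] theorem dualRight_apply {x y z : A} (f : x ⟶ y) (γ : Module.Dual k (z ⟶ y))
    (h : z ⟶ x) : dualRight f γ h = γ (h ≫ f) := rfl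

@[simp] theorem dualLeft_apply {x y z : A} (β : Module.Dual k (y ⟶ x)) (g : y ⟶ z)
    (h : z ⟶ x) : dualLeft β g h = β (g ≫ h) := rfl

/-- The repetitive category of `A`. The composite of `(f, β)` and then `(g, γ)` is
`(g f, γ f + g β)`; the products of two elements of the dual bimodule are zero. -/
instance : Category.{max v w} (Repetitive k A) where
  Hom p q := homSubmodule p q
  id p := ⟨(𝟙 p.obj, 0), fun h => absurd rfl h, fun _ => rfl⟩
  comp {p q r} a b :=
    ⟨(a.1.1 ≫ b.1.1, dualRight a.1.1 b.1.2 + dualLeft a.1.2 b.1.1), by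
      obtain ⟨⟨f, β⟩, hf, hβ⟩ := a
      obtain ⟨⟨g, γ⟩, hg, hγ⟩ := b
      dsimp only at hf hβ hg hγ ⊢
      refine ⟨fun h => ?_, fun h => ?_⟩
      · dsimp only
        by_cases h1 : q.idx = p.idx
        · rw [hg (by omega)]; simp
        · rw [hf h1]; simp
      · dsimp only
        have e1 : dualRight f γ = 0 := by
          by_cases h1 : q.idx = p.idx
          · rw [hγ (by omega)]; ext; simp
          · rw [hf h1]; ext; simp
        have e2 : dualLeft β g = 0 := by
          by_cases h1 : q.idx = p.idx + 1
          · rw [hg (by omega)]; ext; simp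
          · rw [hβ h1]; ext; simp
        rw [e1, e2, add_zero]⟩
  id_comp a := by
    apply Subtype.ext
    refine Prod.ext (by simp) ?_
    ext h; simp
  comp_id a := by
    apply Subtype.ext
    refine Prod.ext (by simp) ?_
    ext h; simp
  assoc a b c := by
    apply Subtype.ext
    refine Prod.ext (by simp) ?_
    ext h; simp [add_assoc]

/-- The component in `A(x, y)` of a morphism `x^[i] ⟶ y^[j]`. -/
def homFst {p q : Repetitive k A} (a : p ⟶ q) : p.obj ⟶ q.obj := (show homSubmodule p q from a).1.1

/-- The component in `D A(y, x)` of a morphism `x^[i] ⟶ y^[j]`. -/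
def homSnd {p q : Repetitive k A} (a : p ⟶ q) : Module.Dual k (q.obj ⟶ p.obj) :=
  (show homSubmodule p q from a).1.2

@[ext] theorem hom_ext {p q : Repetitive k A} {a b : p ⟶ q} (h₁ : homFst a = homFst b)
    (h₂ : homSnd a = homSnd b) : a = b := Subtype.ext (Prod.ext h₁ h₂)

/-- Build a morphism from its two components. -/
def mkHom {p q : Repetitive k A} (f : p.obj ⟶ q.obj) (β : Module.Dual k (q.obj ⟶ p.obj))
    (hf : q.idx ≠ p.idx → f = 0) (hβ : q.idx ≠ p.idx + 1 → β = 0) : p ⟶ q :=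
  (⟨(f, β), hf, hβ⟩ : homSubmodule p q)

theorem homFst_eq_zero {p q : Repetitive k A} (a : p ⟶ q) (h : q.idx ≠ p.idx) : homFst a = 0 :=
  (show homSubmodule p q from a).2.1 h

theorem homSnd_eq_zero {p q : Repetitive k A} (a : p ⟶ q) (h : q.idx ≠ p.idx + 1) :
    homSnd a = 0 :=
  (show homSubmodule p q from a).2.2 h

@[simp] theorem homFst_mkHom {p q : Repetitive k A} (f : p.obj ⟶ q.obj)
    (β : Module.Dual k (q.obj ⟶ p.obj)) (hf hβ) : homFst (mkHom (p := p) f β hf hβ) = f := rfl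
@[simp] theorem homSnd_mkHom {p q : Repetitive k A} (f : p.obj ⟶ q.obj)
    (β : Module.Dual k (q.obj ⟶ p.obj)) (hf hβ) : homSnd (mkHom (p := p) f β hf hβ) = β := rfl

@[simp] theorem homFst_id (p : Repetitive k A) : homFst (𝟙 p) = 𝟙 p.obj := rfl
@[simp] theorem homSnd_id (p : Repetitive k A) : homSnd (𝟙 p) = 0 := rfl
@[simp] theorem homFst_comp {p q r : Repetitive k A} (a : p ⟶ q) (b : q ⟶ r) :
    homFst (a ≫ b) = homFst a ≫ homFst b := rfl
@[simp] theorem homSnd_comp {p q r : Repetitive k A} (a : p ⟶ q) (b : q ⟶ r) :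
    homSnd (a ≫ b) = dualRight (homFst a) (homSnd b) + dualLeft (homSnd a) (homFst b) := rfl

instance (p q : Repetitive k A) : AddCommGroup (p ⟶ q) :=
  inferInstanceAs (AddCommGroup (homSubmodule p q))

instance (p q : Repetitive k A) : Module k (p ⟶ q) :=
  inferInstanceAs (Module k (homSubmodule p q))

@[simp] theorem homFst_zero (p q : Repetitive k A) : homFst (0 : p ⟶ q) = 0 := rfl
@[simp] theorem homSnd_zero (p q : Repetitive k A) : homSnd (0 : p ⟶ q) = 0 := rfl
@[simp] theorem homFst_add {p q : Repetitive k A} (a b : p ⟶ q) :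
    homFst (a + b) = homFst a + homFst b := rfl
@[simp] theorem homSnd_add {p q : Repetitive k A} (a b : p ⟶ q) :
    homSnd (a + b) = homSnd a + homSnd b := rfl
@[simp] theorem homFst_smul {p q : Repetitive k A} (c : k) (a : p ⟶ q) :
    homFst (c • a) = c • homFst a := rfl
@[simp] theorem homSnd_smul {p q : Repetitive k A} (c : k) (a : p ⟶ q) :
    homSnd (c • a) = c • homSnd a := rfl

instance : Preadditive (Repetitive k A) where
  add_comp _ _ _ a b c := by
    ext
    · simp
    · simp; abel
  comp_add _ _ _ a b c := by
    ext
    · simp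
    · simp; abel

instance : Linear k (Repetitive k A) where
  smul_comp _ _ _ r a b := by
    ext <;> simp
  comp_smul _ _ _ a r b := by
    ext <;> simp

theorem heq_hom {p q p' q' : Repetitive k A} (h₁ : p = p') (h₂ : q = q') (a : p ⟶ q)
    (b : p' ⟶ q') (h₃ : HEq (homFst a) (homFst b)) (h₄ : HEq (homSnd a) (homSnd b)) :
    HEq a b := by
  subst h₁ h₂
  exact heq_of_eq (hom_ext (eq_of_heq h₃) (eq_of_heq h₄))

/-- Shifting all the indices by `m`. -/
def shift (k : Type w) [Field k] (A : Type u) [Category.{v} A] [Preadditive A] [Linear k A]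
    (m : ℤ) : Repetitive k A ⥤ Repetitive k A where
  obj p := ⟨p.obj, p.idx + m⟩
  map {p q} a := mkHom (p := ⟨p.obj, p.idx + m⟩) (q := ⟨q.obj, q.idx + m⟩)
    (homFst (p := p) (q := q) a) (homSnd (p := p) (q := q) a)
    (fun h => homFst_eq_zero a fun e => h (by dsimp only; omega))
    (fun h => homSnd_eq_zero a fun e => h (by dsimp only; omega))

theorem shift_comp_shift (m n : ℤ) (h : m + n = 0) : shift k A m ⋙ shift k A n = 𝟭 _ := by
  have ho : ∀ p : Repetitive k A, (shift k A m ⋙ shift k A n).obj p = p := fun p => by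
    simp [shift, add_assoc, h]
  refine Functor.hext ho fun p q a => ?_
  exact heq_hom (ho p) (ho q) _ _ HEq.rfl HEq.rfl

/-- The Nakayama automorphism. -/
def nakayama (k : Type w) [Field k] (A : Type u) [Category.{v} A] [Preadditive A] [Linear k A] :
    LinAut k (Repetitive k A) where
  functor := shift k A 1
  inverse := shift k A (-1)
  functor_inverse := shift_comp_shift 1 (-1) (by norm_num)
  inverse_functor := shift_comp_shift (-1) 1 (by norm_num)
  additive := ⟨rfl⟩
  linear := ⟨fun _ _ => rfl⟩

/-- The embedding `id^[i] : A ⥤ Â` of `A` as the `i`-th copy `A^[i]`. -/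
def level (k : Type w) [Field k] (A : Type u) [Category.{v} A] [Preadditive A] [Linear k A]
    (i : ℤ) : A ⥤ Repetitive k A where
  obj x := ⟨x, i⟩
  map {x y} f := mkHom (p := ⟨x, i⟩) (q := ⟨y, i⟩) f 0 (fun h => absurd rfl h) (fun _ => rfl)
  map_comp f g := by
    ext <;> simp

/-- `φ` has jump `n`: it sends `A^[0]` onto `A^[n]`. (These are full subcategories, so this is a
condition on the objects.) -/
def HasJump (φ : LinAut k (Repetitive k A)) (n : ℤ) : Prop :=
  (fun p => φ.functor.obj p) '' {p | p.idx = 0} = {p | p.idx = n}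

theorem nakayama_obj (p : Repetitive k A) :
    (nakayama k A).functor.obj p = ⟨p.obj, p.idx + 1⟩ := rfl

theorem nakayama_zpow_obj (n : ℤ) (p : Repetitive k A) :
    ((nakayama k A) ^ n).functor.obj p = ⟨p.obj, p.idx + n⟩ := by
  induction n with
  | zero => rw [LinAut.zpow_zero_obj]; simp
  | succ n ih =>
    rw [add_comm, LinAut.zpow_add_obj, ih, zpow_one, nakayama_obj]
    simp [add_assoc, add_comm]
  | pred n ih =>
    rw [sub_eq_add_neg, add_comm, LinAut.zpow_add_obj, ih, zpow_neg_one]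
    change (⟨p.obj, p.idx + -(n : ℤ) + -1⟩ : Repetitive k A) = _
    congr 1; ring

/-- An intrinsic description of `ν u` (used only to compare automorphisms with `ν`). -/
def IsSocleTarget (p q : Repetitive k A) : Prop :=
  ∀ (r : Repetitive k A) (g : p ⟶ r), g ≠ 0 → ∃ h : r ⟶ q, g ≫ h ≠ 0

theorem isSocleTarget_nakayama (p : Repetitive k A) :
    IsSocleTarget p ((nakayama k A).functor.obj p) := by
  intro r g hg
  by_cases hf : homFst g = 0
  · have hs : homSnd g ≠ 0 := fun h => hg (hom_ext hf h)
    have hr : r.idx = p.idx + 1 := by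
      by_contra h; exact hs (homSnd_eq_zero g h)
    obtain ⟨c, hc⟩ : ∃ c, homSnd g c ≠ 0 := by
      by_contra! h; exact hs (LinearMap.ext h)
    refine ⟨mkHom (p := r) (q := (nakayama k A).functor.obj p) (show r.obj ⟶ p.obj from c) 0
      (fun h => absurd hr.symm h) (fun _ => rfl), fun h => hc ?_⟩
    have h2 := congrArg (fun a => homSnd (p := p) (q := (nakayama k A).functor.obj p) a (𝟙 p.obj)) h
    have h3 : (0 : Module.Dual k (p.obj ⟶ r.obj)) (𝟙 p.obj ≫ homFst g) +
        homSnd g (c ≫ 𝟙 p.obj) = 0 := h2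
    simpa using h3
  · have hr : r.idx = p.idx := by
      by_contra h; exact hf (homFst_eq_zero g h)
    obtain ⟨β, hβ⟩ : ∃ β : Module.Dual k (p.obj ⟶ r.obj), β (homFst g) ≠ 0 := by
      by_contra! h; exact hf ((Module.forall_dual_apply_eq_zero_iff k _).1 h)
    have hz : homSnd g = 0 := homSnd_eq_zero g (by omega)
    refine ⟨mkHom (p := r) (q := (nakayama k A).functor.obj p) 0
      (show Module.Dual k (p.obj ⟶ r.obj) from β)
      (fun _ => rfl) (fun h => absurd (by rw [nakayama_obj, hr]) h), fun h => hβ ?_⟩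
    have h2 := congrArg (fun a => homSnd (p := p) (q := (nakayama k A).functor.obj p) a (𝟙 p.obj)) h
    have h3 : β (𝟙 p.obj ≫ homFst g) +
        homSnd g ((0 : r.obj ⟶ p.obj) ≫ 𝟙 p.obj) = 0 := h2
    simpa using h3

theorem exists_smul_id (hc : HasNoNonzeroOrientedCycles k A) {x : A} (f : x ⟶ x) :
    ∃ t : k, f = t • 𝟙 x := by
  obtain ⟨e⟩ := hc x
  refine ⟨e f, e.injective ?_⟩
  change e f = e (e f • (1 : End x))
  rw [map_smul, map_one]
  simp

theorem eq_nakayama_of_isSocleTarget (hs : ∀ x y : A, Nonempty (x ≅ y) → x = y)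
    (hc : HasNoNonzeroOrientedCycles k A) {p q : Repetitive k A} (h : IsSocleTarget p q) :
    q = (nakayama k A).functor.obj p := by
  obtain ⟨e⟩ := hc p.obj
  have hid : (𝟙 p.obj : p.obj ⟶ p.obj) ≠ 0 := by
    intro h0
    have h1 : e (1 : End p.obj) = e 0 := congrArg e h0
    rw [map_one, map_zero] at h1
    exact one_ne_zero h1
  obtain ⟨β, hβ⟩ : ∃ β : Module.Dual k (p.obj ⟶ p.obj), β (𝟙 p.obj) ≠ 0 := by
    by_contra! h; exact hid ((Module.forall_dual_apply_eq_zero_iff k _).1 h)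
  obtain ⟨b, hb⟩ := h ⟨p.obj, p.idx + 1⟩
    (mkHom (p := p) (q := ⟨p.obj, p.idx + 1⟩) 0 β (fun _ => rfl) (fun h => absurd rfl h))
    (fun h => hβ (by
      have h2 := congrArg (fun a => homSnd (p := p) (q := ⟨p.obj, p.idx + 1⟩) a (𝟙 p.obj)) h
      simpa using h2))
  have hne : dualLeft β (homFst (p := ⟨p.obj, p.idx + 1⟩) (q := q) b) ≠ 0 := fun h0 => hb (by
    ext
    · simp
    · simp [h0])
  have hq : q.idx = p.idx + 1 := by
    by_contra hq
    refine hne ?_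
    rw [homFst_eq_zero b hq]
    ext; simp
  obtain ⟨d, hd⟩ : ∃ d, dualLeft β (homFst (p := ⟨p.obj, p.idx + 1⟩) (q := q) b) d ≠ 0 := by
    by_contra! h; exact hne (LinearMap.ext h)
  set c : p.obj ⟶ q.obj := homFst (p := ⟨p.obj, p.idx + 1⟩) (q := q) b
  obtain ⟨t, ht⟩ := exists_smul_id hc (c ≫ d)
  obtain ⟨s, hs'⟩ := exists_smul_id hc (d ≫ c)
  rw [dualLeft_apply, ht, map_smul] at hd
  have ht0 : t ≠ 0 := fun h0 => hd (by rw [h0, zero_smul])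
  have hc0 : c ≠ 0 := by
    intro h0
    rw [h0, Limits.zero_comp] at ht
    exact (smul_ne_zero ht0 hid) ht.symm
  have hst : s = t := by
    have h1 : t • c = s • c := by
      calc t • c = (c ≫ d) ≫ c := by rw [ht]; simp
        _ = c ≫ (d ≫ c) := by simp
        _ = s • c := by rw [hs']; simp
    exact (smul_left_injective k hc0 h1).symm
  have hobj : p.obj = q.obj := hs _ _ ⟨⟨c, t⁻¹ • d, by
    rw [Linear.comp_smul, ht, smul_smul, inv_mul_cancel₀ ht0, one_smul], by
    rw [Linear.smul_comp, hs', hst, smul_smul, inv_mul_cancel₀ ht0, one_smul]⟩⟩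
  rw [nakayama_obj]
  exact Repetitive.ext hobj.symm hq

theorem IsSocleTarget.map (φ : LinAut k (Repetitive k A)) {p q : Repetitive k A}
    (h : IsSocleTarget p q) : IsSocleTarget (φ.functor.obj p) (φ.functor.obj q) := by
  intro r g hg
  obtain ⟨r, rfl⟩ : ∃ r', φ.functor.obj r' = r := ⟨_, φ.functor_obj_inverse_obj r⟩
  obtain ⟨g, rfl⟩ := φ.functor.map_surjective g
  obtain ⟨b, hb⟩ := h r g (fun h0 => hg (by rw [h0]; simp))
  refine ⟨φ.functor.map b, fun h0 => hb ?_⟩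
  apply φ.functor.map_injective
  rw [Functor.map_comp, h0, Functor.map_zero]

theorem nakayama_comm_obj (hs : ∀ x y : A, Nonempty (x ≅ y) → x = y)
    (hc : HasNoNonzeroOrientedCycles k A) (φ : LinAut k (Repetitive k A)) (p : Repetitive k A) :
    φ.functor.obj ((nakayama k A).functor.obj p) =
      (nakayama k A).functor.obj (φ.functor.obj p) :=
  eq_nakayama_of_isSocleTarget hs hc ((isSocleTarget_nakayama p).map φ)

theorem apply_shift_obj (hs : ∀ x y : A, Nonempty (x ≅ y) → x = y)
    (hc : HasNoNonzeroOrientedCycles k A) (φ : LinAut k (Repetitive k A)) (n : ℤ) :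
    ∀ (x : A) (i : ℤ), φ.functor.obj ⟨x, i + n⟩ =
      ⟨(φ.functor.obj ⟨x, i⟩).obj, (φ.functor.obj ⟨x, i⟩).idx + n⟩ := by
  have key := fun x i => nakayama_comm_obj hs hc φ ⟨x, i⟩
  simp only [nakayama_obj] at key
  induction n with
  | zero => intro x i; simp
  | succ n ih =>
    intro x i
    rw [← add_assoc, key, ih, add_assoc]
  | pred n ih =>
    intro x i
    have h1 := key x (i + (-(n : ℤ) - 1))
    rw [show i + (-(n : ℤ) - 1) + 1 = i + -(n : ℤ) by ring, ih] at h1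
    have h2 := congrArg Repetitive.obj h1
    have h3 := congrArg Repetitive.idx h1
    dsimp only at h2 h3
    refine Repetitive.ext h2.symm ?_
    dsimp only
    omega

/-- If `φ` has jump `n`, then `φ ν^(-n)` has jump `0`. -/
theorem HasJump.mul_nakayama_zpow (hA : IsLocallyBounded k A)
    (hc : HasNoNonzeroOrientedCycles k A) {φ : LinAut k (Repetitive k A)} {n : ℤ}
    (h : HasJump φ n) : HasJump (φ * nakayama k A ^ (-n)) 0 := by
  have hobj : ∀ p : Repetitive k A, (φ * nakayama k A ^ (-n)).functor.obj p =
      ⟨(φ.functor.obj p).obj, (φ.functor.obj p).idx + -n⟩ := fun p => by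
    rw [LinAut.mul_functor, Functor.comp_obj, nakayama_zpow_obj,
      apply_shift_obj hA.eq_of_iso hc]
  apply Set.eq_of_subset_of_subset
  · rintro _ ⟨p, hp, rfl⟩
    have : φ.functor.obj p ∈ {p : Repetitive k A | p.idx = n} := h ▸ ⟨p, hp, rfl⟩
    simp only [Set.mem_ofPred_eq] at this ⊢
    rw [hobj, this]; simp
  · intro q hq
    have : (⟨q.obj, n⟩ : Repetitive k A) ∈ (fun p => φ.functor.obj p) '' {p | p.idx = 0} := by
      rw [h]; rfl
    obtain ⟨p, hp, hpq⟩ := this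
    refine ⟨p, hp, ?_⟩
    dsimp only at hpq ⊢
    rw [hobj, hpq]
    refine Repetitive.ext rfl ?_
    have : q.idx = 0 := hq
    simp [this]

/-! The automorphism of `A` induced on `A^[0]`. -/

/-- `x ↦` the object of `A` underlying `θ (x^[0])`, `f ↦` the morphism underlying `θ (f^[0])`. -/
def zerothFunctor (θ : LinAut k (Repetitive k A)) : A ⥤ A where
  obj x := (θ.functor.obj ((level k A 0).obj x)).obj
  map f := homFst (θ.functor.map ((level k A 0).map f))
  map_id x := by simp
  map_comp f g := by simp

theorem zerothFunctor_comp (θ θ' : LinAut k (Repetitive k A)) (h : HasJump θ 0)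
    (hinv : θ.functor ⋙ θ'.functor = 𝟭 _) :
    zerothFunctor θ ⋙ zerothFunctor θ' = 𝟭 A := by
  have hidx : ∀ x : A, (θ.functor.obj ⟨x, 0⟩).idx = 0 := fun x => by
    have : θ.functor.obj ⟨x, 0⟩ ∈ {p : Repetitive k A | p.idx = 0} :=
      h ▸ ⟨⟨x, 0⟩, rfl, rfl⟩
    exact this
  have hlev : ∀ x : A, (level k A 0).obj (θ.functor.obj ((level k A 0).obj x)).obj =
      θ.functor.obj ((level k A 0).obj x) := fun x =>
    Repetitive.ext rfl (hidx x).symm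
  have hlevm : ∀ {x y : A} (f : x ⟶ y),
      HEq ((level k A 0).map (homFst (θ.functor.map ((level k A 0).map f))))
        (θ.functor.map ((level k A 0).map f)) := fun {x y} f => by
    refine heq_hom (hlev x) (hlev y) _ _ HEq.rfl (heq_of_eq ?_)
    refine (homSnd_eq_zero (θ.functor.map ((level k A 0).map f)) ?_).symm
    change (θ.functor.obj ⟨y, 0⟩).idx ≠ (θ.functor.obj ⟨x, 0⟩).idx + 1
    rw [hidx, hidx]; norm_num
  have hfst : ∀ {p q p' q' : Repetitive k A} (_ : p = p') (_ : q = q') (a : p ⟶ q)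
      (b : p' ⟶ q'), HEq a b → HEq (homFst a) (homFst b) := by
    rintro p q _ _ rfl rfl a b hab
    rw [eq_of_heq hab]
  have hmap : ∀ {p q p' q' : Repetitive k A} (_ : p = p') (_ : q = q') (a : p ⟶ q)
      (b : p' ⟶ q'), HEq a b → HEq (θ'.functor.map a) (θ'.functor.map b) := by
    rintro p q _ _ rfl rfl a b hab
    rw [eq_of_heq hab]
  have hinv_obj : ∀ p, θ'.functor.obj (θ.functor.obj p) = p := fun p =>
    Functor.congr_obj hinv p
  have hobj : ∀ x : A, θ'.functor.obj ((level k A 0).obj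
      (θ.functor.obj ((level k A 0).obj x)).obj) = (level k A 0).obj x := fun x => by
    rw [hlev, hinv_obj]
  refine Functor.hext (fun x => congrArg Repetitive.obj (hobj x)) fun x y f => ?_
  change HEq (homFst (θ'.functor.map ((level k A 0).map
    (homFst (θ.functor.map ((level k A 0).map f)))))) (homFst ((level k A 0).map f))
  refine hfst (hobj x) (hobj y) _ _ ((hmap (hlev x) (hlev y) _ _ (hlevm f)).trans ?_)
  exact (Functor.hcongr_hom hinv _)

theorem HasJump.inv_zero {θ : LinAut k (Repetitive k A)} (h : HasJump θ 0) :
    HasJump θ⁻¹ 0 := by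
  apply Set.eq_of_subset_of_subset
  · rintro _ ⟨p, hp, rfl⟩
    have hp' : p ∈ {p : Repetitive k A | p.idx = 0} := hp
    rw [← h] at hp'
    obtain ⟨q, hq, rfl⟩ := hp'
    dsimp only
    rw [LinAut.inv_functor, LinAut.inverse_obj_functor_obj]
    exact hq
  · intro q hq
    refine ⟨θ.functor.obj q, ?_, θ.inverse_obj_functor_obj q⟩
    exact h ▸ ⟨q, hq, rfl⟩

/-- The automorphism `(id^[0])⁻¹ θ id^[0]` of `A` for an automorphism `θ` of `Â` with jump `0`. -/
def restrictZero (θ : LinAut k (Repetitive k A)) (h : HasJump θ 0) : LinAut k A where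
  functor := zerothFunctor θ
  inverse := zerothFunctor θ⁻¹
  functor_inverse := zerothFunctor_comp θ θ⁻¹ h θ.functor_inverse
  inverse_functor := zerothFunctor_comp θ⁻¹ θ h.inv_zero θ.inverse_functor
  additive := ⟨fun {x y f g} => by
    have : (level k A 0).map (f + g) = (level k A 0).map f + (level k A 0).map g := by
      refine hom_ext ?_ ?_
      · rfl
      · exact (add_zero (0 : Module.Dual k (y ⟶ x))).symm
    simp only [zerothFunctor, this]
    rw [Functor.map_add]; rfl⟩
  linear := ⟨fun {x y} f c => by
    have : (level k A 0).map (c • f) = c • (level k A 0).map f := by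
      refine hom_ext ?_ ?_
      · rfl
      · exact (smul_zero (A := Module.Dual k (y ⟶ x)) c).symm
    simp only [zerothFunctor, this]
    rw [Functor.map_smul]; rfl⟩

theorem restrictZero_comp_level (θ : LinAut k (Repetitive k A)) (h : HasJump θ 0) :
    (restrictZero θ h).functor ⋙ level k A 0 = level k A 0 ⋙ θ.functor := by
  have hidx : ∀ x : A, (θ.functor.obj ⟨x, 0⟩).idx = 0 := fun x => by
    have : θ.functor.obj ⟨x, 0⟩ ∈ {p : Repetitive k A | p.idx = 0} :=
      h ▸ ⟨⟨x, 0⟩, rfl, rfl⟩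
    exact this
  have ho : ∀ x, (level k A 0).obj ((restrictZero θ h).functor.obj x) =
      θ.functor.obj ((level k A 0).obj x) := fun x => Repetitive.ext rfl (hidx x).symm
  refine Functor.hext ho fun x y f => ?_
  refine heq_hom (ho x) (ho y) _ _ HEq.rfl (heq_of_eq ?_)
  refine (homSnd_eq_zero (θ.functor.map ((level k A 0).map f)) ?_).symm
  change (θ.functor.obj ⟨y, 0⟩).idx ≠ (θ.functor.obj ⟨x, 0⟩).idx + 1
  rw [hidx, hidx]; norm_num

/-- For `φ` with jump `n`, the automorphism `φ₀ = (id^[0])⁻¹ (φ ν^(-n)) id^[0]` of `A`. -/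
def zerothPart (hA : IsLocallyBounded k A) (hc : HasNoNonzeroOrientedCycles k A)
    (φ : LinAut k (Repetitive k A)) {n : ℤ} (h : HasJump φ n) : LinAut k A :=
  restrictZero (φ * nakayama k A ^ (-n)) (h.mul_nakayama_zpow hA hc)

end Repetitive

/-! ### Bound quiver presentations, walks and simple cycles -/

/-- The composite in `A` of the images of the arrows of a path. -/
def evalPath {V : Type u'} [Quiver.{v'} V] {A : Type u} [Category.{v} A] (vertex : V → A)
    (arrow : ∀ {x y : V}, (x ⟶ y) → (vertex x ⟶ vertex y)) {x : V} :
    ∀ {y : V}, Quiver.Path x y → (vertex x ⟶ vertex y)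
  | _, Quiver.Path.nil => 𝟙 (vertex x)
  | _, Quiver.Path.cons p α => evalPath vertex arrow p ≫ arrow α

/-- A presentation `A ≅ k Q / I` of a finite `k`-category by a quiver `Q` (with vertex set `V`) and
an admissible ideal `I`: a bijection from the vertices to the objects, and a morphism `ᾱ` for each
arrow `α`, such that the induced map from `k Q` is surjective on morphisms and its kernel `I`
satisfies `R^m ⊆ I ⊆ R^2` for some `m`, where `R` is the ideal generated by the arrows. -/
structure QuiverPresentation (k : Type w) [Field k] (V : Type u') [Quiver.{v'} V] (A : Type u)
    [Category.{v} A] [Preadditive A] [Linear k A] where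
  vertex : V ≃ A
  arrow : ∀ {x y : V}, (x ⟶ y) → (vertex x ⟶ vertex y)
  surjective : ∀ x y : V, Function.Surjective
    (Finsupp.linearCombination k (fun p : Quiver.Path x y => evalPath vertex arrow p))
  two_le_length : ∀ {x y : V} (r : Quiver.Path x y →₀ k),
    Finsupp.linearCombination k (fun p : Quiver.Path x y => evalPath vertex arrow p) r = 0 →
      ∀ p ∈ r.support, 2 ≤ p.length
  exists_bound : ∃ m : ℕ, ∀ {x y : V} (p : Quiver.Path x y), m ≤ p.length →
    evalPath vertex arrow p = 0

/-- Closed walks in the quiver `V`, i.e. closed paths in its double quiver. -/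
abbrev ClosedWalk (V : Type u') [Quiver.{v'} V] : Type (max u' v') :=
  Σ x : Quiver.Symmetrify V, Quiver.Path x x

namespace ClosedWalk

variable {V : Type u'} [Quiver.{v'} V]

/-- A cycle `l_m ⋯ l_1` (`m ≥ 1`) is simple if the sources of `l_1, …, l_m` are distinct. The list
of vertices of a path contains the sources of its arrows and, at the end, its target. -/
def IsSimple (C : ClosedWalk V) : Prop :=
  0 < C.2.length ∧ C.2.vertices.dropLast.Nodup

/-- `D` is a rotation of `C`: for some decomposition of `C` as "first `p`, then `q`", `D` is
"first `q`, then `p`". -/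
def IsRotation (C D : ClosedWalk V) : Prop :=
  ∃ (x y : Quiver.Symmetrify V) (p : Quiver.Path x y) (q : Quiver.Path y x),
    C = ⟨x, p.comp q⟩ ∧ D = ⟨y, q.comp p⟩

/-- The inverse walk. -/
def inverse (C : ClosedWalk V) : ClosedWalk V := ⟨C.1, C.2.reverse⟩

/-- Cycles are equivalent if one is a rotation of the other or of its inverse. -/
def Equivalent (C D : ClosedWalk V) : Prop := IsRotation C D ∨ IsRotation C D.inverse

/-- `S` is a complete set of representatives of the equivalence classes of simple cycles. -/
def IsCompleteRepresentatives (S : Set (ClosedWalk V)) : Prop :=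
  (∀ C ∈ S, C.IsSimple) ∧ ∀ C : ClosedWalk V, C.IsSimple → ∃! D, D ∈ S ∧ Equivalent C D

/-- The product of the scalars `c` along a closed walk; an arrow that is traversed backwards
contributes the inverse of its scalar. -/
def scalar {k : Type w} [Field k] (c : ∀ {x y : V}, (x ⟶ y) → kˣ) (C : ClosedWalk V) : kˣ :=
  C.2.weight (fun {x y : Quiver.Symmetrify V} (e : x ⟶ y) =>
    Sum.elim (fun α : (show V from x) ⟶ (show V from y) => c α)
      (fun α : (show V from y) ⟶ (show V from x) => (c α)⁻¹) e)

end ClosedWalk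

/-- `E` fixes the source and the target of `f`, and `E(f) = c f`. -/
def LinAut.ScalesBy {k : Type w} [Field k] {A : Type u} [Category.{v} A] [Preadditive A]
    [Linear k A] (E : LinAut k A) {x y : A} (f : x ⟶ y) (c : kˣ) : Prop :=
  ∃ (hx : E.functor.obj x = x) (hy : E.functor.obj y = y),
    E.functor.map f = eqToHom hx ≫ ((c : k) • f) ≫ eqToHom hy.symm

/-! ### `ℤ`-graded categories -/

/-- A `ℤ`-grading on a `k`-linear category. -/
structure LinGrading (k : Type w) [Field k] (B : Type u) [Category.{v} B] [Preadditive B]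
    [Linear k B] where
  deg : ∀ x y : B, ℤ → Submodule k (x ⟶ y)
  isInternal : ∀ x y : B, DirectSum.IsInternal (deg x y)
  comp_mem : ∀ {x y z : B} {a b : ℤ} {f : x ⟶ y} {g : y ⟶ z},
    f ∈ deg x y a → g ∈ deg y z b → f ≫ g ∈ deg x z (b + a)

section Graded

variable {k : Type w} [Field k]
  {B : Type u} [Category.{v} B] [Preadditive B] [Linear k B]
  {B' : Type u'} [Category.{v'} B'] [Preadditive B'] [Linear k B']

/-- `(H, r)` is a degree-preserving (`k`-linear) functor with degree adjuster `r`. -/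
structure IsDegreePreserving (𝓑 : LinGrading k B) (𝓑' : LinGrading k B') (H : B ⥤ B')
    (r : B → ℤ) : Prop where
  additive : H.Additive
  linear : H.Linear k
  map_mem : ∀ {x y : B} {a : ℤ} {f : x ⟶ y}, f ∈ 𝓑.deg x y (r y + a) →
    H.map f ∈ 𝓑'.deg (H.obj x) (H.obj y) (a + r x)

/-- `θ` is a morphism `(H, r) ⟶ (I, s)` of degree-preserving functors. -/
def IsDegreeMorphism (𝓑' : LinGrading k B') {H I : B ⥤ B'} (r s : B → ℤ) (θ : H ⟶ I) : Prop :=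
  ∀ x : B, θ.app x ∈ 𝓑'.deg (H.obj x) (I.obj x) (-(s x) + r x)

/-- `(H, r)` is an equivalence in the 2-category of `ℤ`-graded `k`-categories, degree-preserving
functors and their morphisms: there are a degree-preserving functor `(I, s)` backwards and
invertible 2-morphisms between the composites (whose adjusters are `x ↦ r x + s (H x)` and
`x ↦ s x + r (I x)`) and the identities. -/
def IsGradedEquivalence (𝓑 : LinGrading k B) (𝓑' : LinGrading k B') (H : B ⥤ B')
    (r : B → ℤ) : Prop :=
  IsDegreePreserving 𝓑 𝓑' H r ∧
    ∃ (I : B' ⥤ B) (s : B' → ℤ) (ε : 𝟭 B ≅ H ⋙ I) (δ : I ⋙ H ≅ 𝟭 B'),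
      IsDegreePreserving 𝓑' 𝓑 I s ∧
      IsDegreeMorphism 𝓑 (fun _ => 0) (fun x => r x + s (H.obj x)) ε.hom ∧
      IsDegreeMorphism 𝓑 (fun x => r x + s (H.obj x)) (fun _ => 0) ε.inv ∧
      IsDegreeMorphism 𝓑' (fun x => s x + r (I.obj x)) (fun _ => 0) δ.hom ∧
      IsDegreeMorphism 𝓑' (fun _ => 0) (fun x => s x + r (I.obj x)) δ.inv

/-- `H` is an isomorphism of `ℤ`-graded categories: it preserves degrees strictly and has a strict
inverse with the same property. -/
def IsGradedIso (𝓑 : LinGrading k B) (𝓑' : LinGrading k B') (H : B ⥤ B') : Prop :=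
  IsDegreePreserving 𝓑 𝓑' H (fun _ => 0) ∧
    ∃ I : B' ⥤ B, IsDegreePreserving 𝓑' 𝓑 I (fun _ => 0) ∧ H ⋙ I = 𝟭 B ∧ I ⋙ H = 𝟭 B'

end Graded

/-- The category with object set `J` and with the morphisms of `B` between the objects `ι j`; for
injective `ι` this is the full subcategory of `B` on the objects `ι j`. -/
structure FullOn {J : Type u'} {B : Type u} (ι : J → B) where
  pt : J

namespace FullOn

variable {k : Type w} [Field k] {J : Type u'} {B : Type u} [Category.{v} B] [Preadditive B]
  [Linear k B] {B' : Type u} [Category.{v} B'] [Preadditive B'] [Linear k B']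

instance (ι : J → B) : Category.{v} (FullOn ι) where
  Hom i j := ι i.pt ⟶ ι j.pt
  id i := 𝟙 (ι i.pt)
  comp f g := CategoryStruct.comp (obj := B) f g
  id_comp f := Category.id_comp (obj := B) f
  comp_id f := Category.comp_id (obj := B) f
  assoc f g h := Category.assoc (obj := B) f g h

instance (ι : J → B) : Preadditive (FullOn ι) where
  homGroup i j := inferInstanceAs (AddCommGroup (ι i.pt ⟶ ι j.pt))
  add_comp _ _ _ f g h := Preadditive.add_comp (C := B) _ _ _ f g h
  comp_add _ _ _ f g h := Preadditive.comp_add (C := B) _ _ _ f g h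

instance (ι : J → B) : Linear k (FullOn ι) where
  homModule i j := inferInstanceAs (Module k (ι i.pt ⟶ ι j.pt))
  smul_comp _ _ _ r f g := Linear.smul_comp (C := B) _ _ _ r f g
  comp_smul _ _ _ f r g := Linear.comp_smul (C := B) _ _ _ f r g

/-- The inherited grading. -/
def grading (𝓑 : LinGrading k B) (ι : J → B) : LinGrading k (FullOn ι) where
  deg i j a := 𝓑.deg (ι i.pt) (ι j.pt) a
  isInternal i j := 𝓑.isInternal (ι i.pt) (ι j.pt)
  comp_mem hf hg := 𝓑.comp_mem hf hg

/-- The restriction of a functor to the full subcategories on `ι` and on the image of `ι`. -/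
def restrict (H : B ⥤ B') (ι : J → B) : FullOn ι ⥤ FullOn (fun j => H.obj (ι j)) where
  obj i := ⟨i.pt⟩
  map {i j} f := H.map (X := ι i.pt) (Y := ι j.pt) f
  map_id i := H.map_id (ι i.pt)
  map_comp {i j l} f g := H.map_comp (X := ι i.pt) (Y := ι j.pt) (Z := ι l.pt) f g

end FullOn

/-! ### Orbit categories -/

/-- The orbit category `C / ⟨g⟩` of `C` with the `ℤ`-action `a ↦ g ^ a`: it has the same objects
as `C`. The action need not be free. -/
structure OrbitCat {k : Type w} [Field k] {C : Type u} [Category.{v} C] [Preadditive C]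
    [Linear k C] (g : LinAut k C) where
  pt : C

namespace OrbitCat

open DirectSum

variable {k : Type w} [Field k] {C : Type u} [Category.{v} C] [Preadditive C] [Linear k C]

/-- `(C / ⟨g⟩)(x, y) = ⨁ a, C (g ^ a x, y)`. -/
abbrev HomSum (g : LinAut k C) (x y : C) : Type v :=
  ⨁ a : ℤ, ((g ^ a).functor.obj x ⟶ y)

/-- The composite `u' ∘ g ^ b (u)`, of degree `b + a`, of `u` of degree `a` and then `u'` of
degree `b`. -/
noncomputable def compAt (g : LinAut k C) (x y z : C) (a b : ℤ) :
    ((g ^ a).functor.obj x ⟶ y) →ₗ[k] ((g ^ b).functor.obj y ⟶ z) →ₗ[k] HomSum g x z :=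
  LinearMap.mk₂ k
    (fun u u' => lof k ℤ (fun a : ℤ => ((g ^ a).functor.obj x ⟶ z)) (b + a)
      (eqToHom (g.zpow_add_obj a b x) ≫ (g ^ b).functor.map u ≫ u'))
    (fun u₁ u₂ u' => by simp) (fun c u u' => by simp) (fun u u₁ u₂ => by simp)
    (fun c u u' => by simp)

/-- The composition of the orbit category. -/
noncomputable def compHom (g : LinAut k C) (x y z : C) :
    HomSum g x y →ₗ[k] HomSum g y z →ₗ[k] HomSum g x z :=
  toModule k ℤ _ fun a => (toModule k ℤ _ fun b => (compAt g x y z a b).flip).flip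

theorem compHom_lof (g : LinAut k C) {x y z : C} {a b : ℤ} (u : (g ^ a).functor.obj x ⟶ y)
    (u' : (g ^ b).functor.obj y ⟶ z) :
    compHom g x y z (lof k ℤ (fun a : ℤ => ((g ^ a).functor.obj x ⟶ y)) a u)
      (lof k ℤ (fun a : ℤ => ((g ^ a).functor.obj y ⟶ z)) b u') =
    lof k ℤ (fun a : ℤ => ((g ^ a).functor.obj x ⟶ z)) (b + a)
      (eqToHom (g.zpow_add_obj a b x) ≫ (g ^ b).functor.map u ≫ u') := by
  simp only [compHom, toModule_lof, LinearMap.flip_apply]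
  rfl

theorem lof_congr (g : LinAut k C) {x y : C} {a b : ℤ} (h : a = b)
    (u : (g ^ a).functor.obj x ⟶ y) (u' : (g ^ b).functor.obj x ⟶ y)
    (hu : u = eqToHom (by rw [h]) ≫ u') :
    lof k ℤ (fun a : ℤ => ((g ^ a).functor.obj x ⟶ y)) a u =
      lof k ℤ (fun a : ℤ => ((g ^ a).functor.obj x ⟶ y)) b u' := by
  subst h
  rw [hu]; simp

/-- The identity of `x` in the orbit category is the identity of `x = g ^ 0 x`, in degree `0`. -/
noncomputable def idHom (g : LinAut k C) (x : C) : HomSum g x x :=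
  lof k ℤ (fun a : ℤ => ((g ^ a).functor.obj x ⟶ x)) 0 (eqToHom (g.zpow_zero_obj x))

theorem hom_induction (g : LinAut k C) {x y : C} {P : HomSum g x y → Prop} (u : HomSum g x y)
    (h0 : P 0) (hlof : ∀ (a : ℤ) (u : (g ^ a).functor.obj x ⟶ y),
      P (lof k ℤ (fun a : ℤ => ((g ^ a).functor.obj x ⟶ y)) a u))
    (hadd : ∀ u v, P u → P v → P (u + v)) : P u :=
  DirectSum.induction_on u h0 hlof hadd

theorem compHom_assoc (g : LinAut k C) {x y z t : C} (u : HomSum g x y) (u' : HomSum g y z)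
    (u'' : HomSum g z t) :
    compHom g x z t (compHom g x y z u u') u'' = compHom g x y t u (compHom g y z t u' u'') := by
  induction u using hom_induction with
  | h0 => simp
  | hadd u v hu hv => simp only [map_add, LinearMap.add_apply, hu, hv]
  | hlof a u =>
  induction u' using hom_induction with
  | h0 => simp
  | hadd u v hu hv => simp only [map_add, LinearMap.add_apply, hu, hv]
  | hlof b u' =>
  induction u'' using hom_induction with
  | h0 => simp
  | hadd u v hu hv => simp only [map_add, hu, hv]
  | hlof c u'' =>
  rw [compHom_lof, compHom_lof, compHom_lof, compHom_lof]
  refine lof_congr g (add_assoc c b a).symm _ _ ?_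
  rw [Functor.congr_hom (g.zpow_add_functor b c) u]
  simp [eqToHom_map]

theorem idHom_compHom (g : LinAut k C) {x y : C} (u : HomSum g x y) :
    compHom g x x y (idHom g x) u = u := by
  induction u using hom_induction with
  | h0 => simp
  | hadd u v hu hv => simp only [map_add, hu, hv]
  | hlof a u =>
  rw [idHom, compHom_lof]
  refine lof_congr g (add_zero a) _ _ ?_
  simp [eqToHom_map]

theorem compHom_idHom (g : LinAut k C) {x y : C} (u : HomSum g x y) :
    compHom g x y y u (idHom g y) = u := by
  induction u using hom_induction with
  | h0 => simp
  | hadd u v hu hv => simp only [map_add, LinearMap.add_apply, hu, hv]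
  | hlof a u =>
  rw [idHom, compHom_lof]
  refine lof_congr g (zero_add a) _ _ ?_
  have h0 : (g ^ (0 : ℤ)).functor = 𝟭 C := by rw [zpow_zero]; rfl
  rw [Functor.congr_hom h0 u]
  simp

noncomputable instance (g : LinAut k C) : Category.{v} (OrbitCat g) where
  Hom x y := HomSum g x.pt y.pt
  id x := idHom g x.pt
  comp u u' := compHom g _ _ _ u u'
  id_comp u := idHom_compHom g u
  comp_id u := compHom_idHom g u
  assoc u u' u'' := compHom_assoc g u u' u''

noncomputable instance (g : LinAut k C) : Preadditive (OrbitCat g) where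
  homGroup x y := inferInstanceAs (AddCommGroup (HomSum g x.pt y.pt))
  add_comp x y z u v u' := by
    change compHom g x.pt y.pt z.pt ((show HomSum g x.pt y.pt from u) + v) u' = _
    rw [map_add]; rfl
  comp_add x y z u u' v' := by
    change compHom g x.pt y.pt z.pt u ((show HomSum g y.pt z.pt from u') + v') = _
    rw [map_add]; rfl

noncomputable instance (g : LinAut k C) : Linear k (OrbitCat g) where
  homModule x y := inferInstanceAs (Module k (HomSum g x.pt y.pt))
  smul_comp x y z c u u' := by
    change compHom g x.pt y.pt z.pt (c • (show HomSum g x.pt y.pt from u)) u' = _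
    rw [map_smul]; rfl
  comp_smul x y z u c u' := by
    change compHom g x.pt y.pt z.pt u (c • (show HomSum g y.pt z.pt from u')) = _
    rw [map_smul]; rfl

theorem isInternal_range_lof {M : ℤ → Type v} [∀ a, AddCommGroup (M a)] [∀ a, Module k (M a)] :
    DirectSum.IsInternal (fun a : ℤ => LinearMap.range (lof k ℤ M a)) := by
  let R : (⨁ a, M a) →ₗ[k] ⨁ a : ℤ, LinearMap.range (lof k ℤ M a) :=
    lmap fun a => (lof k ℤ M a).rangeRestrict
  let J : (⨁ a : ℤ, LinearMap.range (lof k ℤ M a)) →ₗ[k] ⨁ a, M a :=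
    DirectSum.coeLinearMap fun a : ℤ => LinearMap.range (lof k ℤ M a)
  have hJR : J ∘ₗ R = LinearMap.id := by
    apply DirectSum.linearMap_ext
    intro a
    ext1 m
    simp [J, R]
  have hRJ : R ∘ₗ J = LinearMap.id := by
    apply DirectSum.linearMap_ext
    rintro a
    ext1 ⟨_, m, rfl⟩
    simp [J, R]
    rfl
  exact Function.bijective_iff_has_inverse.2 ⟨R, fun u => LinearMap.congr_fun hRJ u,
    fun u => LinearMap.congr_fun hJR u⟩

/-- The grading of the orbit category: the part of degree `a` of the morphisms from `x` to `y` is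
`C (g ^ a x, y)`. -/
noncomputable def grading (g : LinAut k C) : LinGrading k (OrbitCat g) where
  deg x y a := LinearMap.range (lof k ℤ (fun a : ℤ => ((g ^ a).functor.obj x.pt ⟶ y.pt)) a)
  isInternal x y := isInternal_range_lof
  comp_mem := by
    rintro x y z a b _ _ ⟨u, rfl⟩ ⟨u', rfl⟩
    exact ⟨_, (compHom_lof g u u').symm⟩

end OrbitCat

/-! ### Equivariant functors and the functors they induce on orbit categories -/

section Equivariant

theorem iso_id_aux {C : Type u} [Category.{v} C] {D : Type u'} [Category.{v'} D] {E : C ⥤ D}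
    {X : C ⥤ C} {Y : D ⥤ D} (hX : X = 𝟭 C) (hY : Y = 𝟭 D)
    (e : E ⋙ Y ≅ X ⋙ E)
    (x : C) (p₁ : Y.obj (E.obj x) = Y.obj (Y.obj (E.obj x)))
    (p₂ : E.obj (X.obj (X.obj x)) = E.obj (X.obj x)) (p₃ : Y.obj (E.obj x) = E.obj (X.obj x))
    (he : e.hom.app x = eqToHom p₁ ≫ Y.map (e.hom.app x) ≫ e.hom.app (X.obj x) ≫ eqToHom p₂) :
    e.hom.app x = eqToHom p₃ := by
  subst hX hY
  have h1 : e.hom.app x = e.hom.app x ≫ e.hom.app x := by simpa using he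
  have h2 : e.hom.app x ≫ 𝟙 (E.obj x) = e.hom.app x ≫ e.hom.app x :=
    (Category.comp_id _).trans h1
  have h3 := (cancel_epi (e.hom.app x)).1 h2
  exact h3.symm

variable {k : Type w} [Field k] {C : Type u} [Category.{v} C] [Preadditive C] [Linear k C]
  {D : Type u'} [Category.{v'} D] [Preadditive D] [Linear k D]

/-- A family `η` that makes `(E, η)` a `ℤ`-equivariant functor from `C` with the action
`a ↦ g ^ a` to `D` with the action `a ↦ h ^ a`: natural isomorphisms
`η_a : h ^ a ∘ E ⇒ E ∘ g ^ a` with `η_(b + a) = (η_b g ^ a) ∘ (h ^ b η_a)`. -/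
structure EquivariantStructure (g : LinAut k C) (h : LinAut k D) (E : C ⥤ D) where
  iso : ∀ a : ℤ, E ⋙ (h ^ a).functor ≅ (g ^ a).functor ⋙ E
  iso_add : ∀ (a b : ℤ) (x : C), (iso (b + a)).hom.app x =
    eqToHom (h.zpow_add_obj a b (E.obj x)) ≫ (h ^ b).functor.map ((iso a).hom.app x) ≫
      (iso b).hom.app ((g ^ a).functor.obj x) ≫
        eqToHom (congrArg E.obj (g.zpow_add_obj a b x).symm)

namespace EquivariantStructure

variable {g : LinAut k C} {h : LinAut k D} {E : C ⥤ D}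

theorem iso_zero (η : EquivariantStructure g h E) (x : C) : (η.iso 0).hom.app x =
    eqToHom ((h.zpow_zero_obj _).trans (congrArg E.obj (g.zpow_zero_obj x).symm)) := by
  have hX : (g ^ (0 : ℤ)).functor = 𝟭 C := by rw [zpow_zero]; rfl
  have hY : (h ^ (0 : ℤ)).functor = 𝟭 D := by rw [zpow_zero]; rfl
  refine iso_id_aux hX hY (η.iso 0) x (h.zpow_add_obj 0 0 (E.obj x))
    (congrArg E.obj (g.zpow_add_obj 0 0 x).symm) _ ?_
  exact η.iso_add 0 0 x

open DirectSum

variable [E.Additive] [E.Linear k]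

/-- The action of `(E, η) / ℤ` on morphisms: `u : g ^ a x ⟶ y` of degree `a` goes to
`E(u) ∘ η_(a, x)`, again of degree `a`. -/
noncomputable def orbitMap (η : EquivariantStructure g h E) (x y : C) :
    OrbitCat.HomSum g x y →ₗ[k] OrbitCat.HomSum h (E.obj x) (E.obj y) :=
  toModule k ℤ _ fun a =>
    (lof k ℤ (fun a : ℤ => ((h ^ a).functor.obj (E.obj x) ⟶ E.obj y)) a) ∘ₗ
      (Linear.leftComp k (E.obj y) ((η.iso a).hom.app x)) ∘ₗ E.mapLinearMap k

theorem orbitMap_lof (η : EquivariantStructure g h E) {x y : C} {a : ℤ}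
    (u : (g ^ a).functor.obj x ⟶ y) :
    η.orbitMap x y (lof k ℤ (fun a : ℤ => ((g ^ a).functor.obj x ⟶ y)) a u) =
      lof k ℤ (fun a : ℤ => ((h ^ a).functor.obj (E.obj x) ⟶ E.obj y)) a
        ((η.iso a).hom.app x ≫ E.map u) := by
  simp only [orbitMap, toModule_lof]
  rfl

/-- The functor `(E, η) / ℤ : C / ⟨g⟩ ⥤ D / ⟨h⟩`. -/
noncomputable def orbitFunctor (η : EquivariantStructure g h E) : OrbitCat g ⥤ OrbitCat h where
  obj x := ⟨E.obj x.pt⟩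
  map {x y} u := η.orbitMap x.pt y.pt u
  map_id x := by
    change η.orbitMap x.pt x.pt (OrbitCat.idHom g x.pt) = OrbitCat.idHom h (E.obj x.pt)
    rw [OrbitCat.idHom, orbitMap_lof, iso_zero, OrbitCat.idHom]
    simp [eqToHom_map]
  map_comp {x y z} u u' := by
    change η.orbitMap x.pt z.pt (OrbitCat.compHom g _ _ _ u u') =
      OrbitCat.compHom h _ _ _ (η.orbitMap x.pt y.pt u) (η.orbitMap y.pt z.pt u')
    induction u using OrbitCat.hom_induction with
    | h0 => simp
    | hadd u v hu hv => simp only [map_add, LinearMap.add_apply, hu, hv]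
    | hlof a u =>
    induction u' using OrbitCat.hom_induction with
    | h0 => simp
    | hadd u v hu hv => simp only [map_add, hu, hv]
    | hlof b u' =>
    rw [OrbitCat.compHom_lof, orbitMap_lof, orbitMap_lof, orbitMap_lof, OrbitCat.compHom_lof,
      iso_add]
    have hn := (η.iso b).hom.naturality u
    simp only [Functor.comp_map] at hn
    simp [eqToHom_map, reassoc_of% hn]

end EquivariantStructure

end Equivariant

/-- `T` contains exactly one object of every orbit of the action `a ↦ g ^ a` on objects. -/
def IsOrbitTransversal {k : Type w} [Field k] {C : Type u} [Category.{v} C] [Preadditive C]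
    [Linear k C] (g : LinAut k C) (T : Set C) : Prop :=
  ∀ x : C, ∃! t, t ∈ T ∧ ∃ a : ℤ, (g ^ a).functor.obj t = x

/-! ### Potentials on quivers -/

/-! The automorphism θ = φ⁻¹ψ fixes all objects of Â, and the point is that it is a twist: for some
function m from the objects to kˣ it multiplies every morphism p ⟶ q by m p / m q. Then ψ = φθ, and
the scalars m p are the components of a natural isomorphism ψ ⇒ φ.

On one copy of A, m comes from the quiver. Conjugation by a power of the Nakayama automorphism
identifies φ₀⁻¹ψ₀ with the action of θ on A^[-n] (`Repetitive.zerothPart_inv_mul_comp_level`), so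
there θ scales each arrow α by c α. Every closed walk can be cut down to simple cycles, so c is
trivial on all closed walks and is therefore the coboundary of a potential on the vertices
(`ClosedWalk.exists_potential`). Since the paths span A, θ is a twist on all of A^[-n]
(`Repetitive.levelAction_eq_of_arrow`).

The dual bimodule carries m to the other copies. As A(x, x) = k, the space Â(x^[i], x^[i+1]) is a
line on which θ acts by a scalar. Composing A(x, y) with DA(x, y) into this line is the evaluation
pairing, which is nondegenerate. So the action on A^[i] determines the one on the morphisms from
A^[i] to A^[i+1], these determine the action on A^[i+1], and the same works downwards. Absorbing the
scalars of the lines into m keeps the action a twist at each level (`Repetitive.exists_eq_twist`).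

Finally m is the value at 1 of a cocycle for the ℤ-action on objects (`exists_int_cocycle`). The
cocycle is an equivariant structure on the identity, and its pointwise inverse induces the strict
inverse functor of orbit categories (`LinAut.exists_equivariantStructure_of_eq_mul_twist`). -/

/-- A path either visits every vertex at most once or contains a closed path of positive length. -/
theorem Quiver.Path.nodup_vertices_or_exists_closed {V : Type u} [Quiver.{v} V] {x y : V}
    (p : Quiver.Path x y) : p.vertices.Nodup ∨
      ∃ (z : V) (a : Quiver.Path x z) (q : Quiver.Path z z) (b : Quiver.Path z y),
        p = a.comp (q.comp b) ∧ 0 < q.length := by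
  induction p with
  | nil => left; simp
  | @cons y z p e ih =>
    rcases ih with h | ⟨t, a, q, b, rfl, hq⟩
    · by_cases hz : z ∈ p.vertices
      -- The last arrow returns to a visited vertex, so the part of the path since that visit closes
      -- up.
      · right
        obtain ⟨a, b, rfl⟩ := p.exists_eq_comp_of_mem_vertices hz
        exact ⟨z, a, b.cons e, .nil, by simp, by simp⟩
      · left
        simp only [Quiver.Path.vertices_cons, List.concat_eq_append]
        refine h.append (List.nodup_singleton z) ?_
        rw [List.disjoint_singleton]
        exact hz
    · exact Or.inr ⟨t, a, q, b.cons e, by simp, hq⟩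

namespace ClosedWalk

variable {V : Type u'} [Quiver.{v'} V] {k : Type w} [Field k]

/-- The scalar of an arrow of the double quiver. -/
def arrowScalar (c : ∀ {x y : V}, (x ⟶ y) → kˣ) {x y : Quiver.Symmetrify V} (e : x ⟶ y) : kˣ :=
  Sum.elim (fun α : (show V from x) ⟶ (show V from y) => c α)
    (fun α : (show V from y) ⟶ (show V from x) => (c α)⁻¹) e

theorem scalar_eq (c : ∀ {x y : V}, (x ⟶ y) → kˣ) (C : ClosedWalk V) :
    scalar c C = C.2.weight (arrowScalar c) := rfl

theorem arrowScalar_reverse (c : ∀ {x y : V}, (x ⟶ y) → kˣ) {x y : Quiver.Symmetrify V}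
    (e : x ⟶ y) : arrowScalar c (Quiver.reverse e) = (arrowScalar c e)⁻¹ := by
  rcases e with α | α
  · rfl
  · exact (inv_inv (c α)).symm

theorem weight_reverse (c : ∀ {x y : V}, (x ⟶ y) → kˣ) {x y : Quiver.Symmetrify V}
    (p : Quiver.Path x y) :
    p.reverse.weight (arrowScalar c) = (p.weight (arrowScalar c))⁻¹ := by
  induction p with
  | nil => simp [Quiver.Path.reverse]
  | cons p e ih =>
    rw [Quiver.Path.reverse, Quiver.Path.weight_comp, ih, Quiver.Path.weight_cons, mul_inv_rev]
    congr 1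
    rw [Quiver.Hom.toPath, Quiver.Path.weight_cons, Quiver.Path.weight_nil, one_mul,
      arrowScalar_reverse]

theorem IsRotation.scalar_eq {C D : ClosedWalk V} (h : IsRotation C D)
    (c : ∀ {x y : V}, (x ⟶ y) → kˣ) : scalar c C = scalar c D := by
  obtain ⟨x, y, p, q, rfl, rfl⟩ := h
  simp only [ClosedWalk.scalar_eq, Quiver.Path.weight_comp]
  exact mul_comm _ _

theorem scalar_inverse (c : ∀ {x y : V}, (x ⟶ y) → kˣ) (C : ClosedWalk V) :
    scalar c C.inverse = (scalar c C)⁻¹ := weight_reverse c C.2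

/-- Since kˣ is commutative, rotating a walk does not change its scalar, and reversing inverts it.
So triviality depends only on the equivalence class. -/
theorem IsSimple.scalar_eq_one {S : Set (ClosedWalk V)} (hS : IsCompleteRepresentatives S)
    (c : ∀ {x y : V}, (x ⟶ y) → kˣ) (hcyc : ∀ Z ∈ S, scalar c Z = 1) {C : ClosedWalk V}
    (hC : C.IsSimple) : scalar c C = 1 := by
  obtain ⟨D, ⟨hD, h | h⟩, -⟩ := hS.2 C hC
  · rw [h.scalar_eq c, hcyc D hD]
  · rw [h.scalar_eq c, scalar_inverse, hcyc D hD, inv_one]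

/-- If the scalars of all simple cycles are trivial, so are those of all closed walks. -/
theorem scalar_eq_one_of_isSimple (c : ∀ {x y : V}, (x ⟶ y) → kˣ)
    (h : ∀ C : ClosedWalk V, C.IsSimple → scalar c C = 1) (C : ClosedWalk V) :
    scalar c C = 1 := by
  obtain ⟨m, hm⟩ : ∃ m, C.2.length = m := ⟨_, rfl⟩
  induction m using Nat.strong_induction_on generalizing C with
  | _ m ih =>
  obtain ⟨x, p⟩ := C
  subst hm
  -- The two endpoints are separated so that `cases` can remove the last arrow.
  generalize hy : x = y at p
  cases p with
  | nil => exact Quiver.Path.weight_nil _ _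
  | @cons z _ p e =>
    subst hy
    -- The vertices of `p`, the walk without its last arrow, are exactly the sources of the arrows
    -- of the walk. If one repeats, both the loop `q` and the walk with `q` cut out are shorter, and
    -- the two scalars multiply to the original one.
    rcases p.nodup_vertices_or_exists_closed with hp | ⟨t, a, q, b, rfl, hq⟩
    · refine h _ ⟨by simp, ?_⟩
      simpa [List.concat_eq_append] using hp
    · have h1 := ih q.length (by simp; omega) ⟨t, q⟩ rfl
      have h2 := ih ((a.comp b).cons e).length (by simp; omega) ⟨_, (a.comp b).cons e⟩ rfl
      rw [scalar_eq] at h1 h2 ⊢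
      dsimp only at h1 h2 ⊢
      simp only [Quiver.Path.weight_comp, Quiver.Path.weight_cons] at h2 ⊢
      rw [h1, one_mul, h2]

/-- If the scalars of all closed walks are trivial, then `c` is the coboundary of a potential. -/
theorem exists_potential (c : ∀ {x y : V}, (x ⟶ y) → kˣ)
    (h : ∀ C : ClosedWalk V, scalar c C = 1) :
    ∃ l : V → kˣ, ∀ {x y : V} (α : x ⟶ y), c α = (l x)⁻¹ * l y := by
  -- A base vertex in the connected component of each vertex; the potential is the scalar of a
  -- chosen walk from it.
  let r : Quiver.Symmetrify V → Quiver.Symmetrify V := fun x =>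
    Quotient.out (Quotient.mk (Quiver.zigzagSetoid V) x)
  have hr : ∀ x : Quiver.Symmetrify V, Nonempty (Quiver.Path (r x) x) := fun x =>
    Quotient.exact (Quotient.out_eq (Quotient.mk (Quiver.zigzagSetoid V) x))
  -- Going out along `p` and `e` and back along `p'` is a closed walk. The starting points are kept
  -- apart because the base vertices of the two ends of an arrow are only propositionally equal.
  have key : ∀ {s t x y : Quiver.Symmetrify V} (_ : s = t) (p : Quiver.Path s x)
      (p' : Quiver.Path t y) (e : x ⟶ y),
      p.weight (arrowScalar c) * arrowScalar c e = p'.weight (arrowScalar c) := by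
    rintro s _ x y rfl p p' e
    have h1 := h ⟨s, (p.cons e).comp p'.reverse⟩
    rw [scalar_eq] at h1
    dsimp only at h1
    rw [Quiver.Path.weight_comp, weight_reverse, Quiver.Path.weight_cons] at h1
    exact mul_inv_eq_one.1 h1
  have hrr : ∀ {x y : Quiver.Symmetrify V} (_ : x ⟶ y), r x = r y := fun {x y} e =>
    congrArg Quotient.out (Quotient.sound (s := Quiver.zigzagSetoid V) ⟨e.toPath⟩)
  have main : ∀ {x y : Quiver.Symmetrify V} (e : x ⟶ y),
      arrowScalar c e = ((hr x).some.weight (arrowScalar c))⁻¹ *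
        (hr y).some.weight (arrowScalar c) := fun {x y} e =>
    eq_inv_mul_of_mul_eq (key (hrr e) _ _ e)
  exact ⟨fun x => (hr x).some.weight (arrowScalar c), fun {x y} α =>
    main (x := x) (y := y) (Sum.inl α)⟩

end ClosedWalk

/-! ### Cocycles for actions of `ℤ` -/

/-- Every function with values in a commutative group is the value at `1` of a cocycle for the
`ℤ`-action generated by a permutation. -/
theorem exists_int_cocycle {X : Type u} {G : Type w} [CommGroup G] (σ : Equiv.Perm X)
    (m : X → G) : ∃ M : ℤ → X → G, M 1 = m ∧
      ∀ (a b : ℤ) (x : X), M (b + a) x = M a x * M b ((σ ^ a) x) := by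
  -- The skew product over σ. The cocycle is the G-component of its powers, so negative exponents
  -- need no separate definition.
  let F : Equiv.Perm (X × G) :=
    { toFun := fun y => (σ y.1, y.2 * m y.1)
      invFun := fun y => (σ.symm y.1, y.2 * (m (σ.symm y.1))⁻¹)
      left_inv := fun y => by simp
      right_inv := fun y => by simp }
  -- The powers of F commute with translation in G; with F ^ (b + a) = F ^ b F ^ a this is the
  -- cocycle identity.
  have hF : ∀ (a : ℤ) (x : X) (t : G), (F ^ a) (x, t) = ((σ ^ a) x, t * ((F ^ a) (x, 1)).2) := by
    intro a
    induction a with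
    | zero => intro x t; simp
    | succ a ih =>
      intro x t
      rw [add_comm, zpow_add, zpow_add, Equiv.Perm.mul_apply, Equiv.Perm.mul_apply,
        Equiv.Perm.mul_apply, ih x t, ih x 1]
      simp [F, mul_assoc]
    | pred a ih =>
      intro x t
      rw [sub_eq_add_neg, add_comm, zpow_add, zpow_add, Equiv.Perm.mul_apply,
        Equiv.Perm.mul_apply, Equiv.Perm.mul_apply, ih x t, ih x 1]
      simp [F, mul_assoc, Equiv.Perm.inv_def]
  refine ⟨fun a x => ((F ^ a) (x, 1)).2, ?_, fun a b x => ?_⟩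
  · ext x; simp [F]
  · dsimp only
    rw [zpow_add, Equiv.Perm.mul_apply, hF a x 1, hF b, one_mul]

/-! ### Twisting by scalars -/

namespace LinAut

variable {k : Type w} [Field k] {C : Type u} [Category.{v} C] [Preadditive C] [Linear k C]

/-- The functor that fixes the objects and multiplies a morphism `x ⟶ y` by `m x / m y`. -/
def twistFunctor (m : C → kˣ) : C ⥤ C where
  obj x := x
  map {x y} f := ((m x * (m y)⁻¹ : kˣ) : k) • f
  map_id x := by simp
  map_comp {x y z} f g := by
    rw [Linear.smul_comp, Linear.comp_smul, smul_smul, ← Units.val_mul]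
    congr 2
    rw [mul_assoc, inv_mul_cancel_left]

theorem twistFunctor_comp (m m' : C → kˣ) :
    twistFunctor (C := C) m ⋙ twistFunctor m' = twistFunctor (m * m') := by
  refine Functor.hext (fun _ => rfl) fun x y f => heq_of_eq ?_
  change ((m' x * (m' y)⁻¹ : kˣ) : k) • (((m x * (m y)⁻¹ : kˣ) : k) • f) = _
  rw [smul_smul, ← Units.val_mul]
  change _ = ((m x * m' x * (m y * m' y)⁻¹ : kˣ) : k) • f
  congr 2
  rw [mul_inv, mul_comm, mul_mul_mul_comm]

theorem twistFunctor_one : twistFunctor (C := C) (1 : C → kˣ) = 𝟭 C := by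
  refine Functor.hext (fun _ => rfl) fun x y f => heq_of_eq ?_
  simp [twistFunctor]

/-- The automorphism that fixes the objects and multiplies a morphism `x ⟶ y` by `m x / m y`. -/
def twist (m : C → kˣ) : LinAut k C where
  functor := twistFunctor m
  inverse := twistFunctor m⁻¹
  functor_inverse := by rw [twistFunctor_comp, mul_inv_cancel, twistFunctor_one]
  inverse_functor := by rw [twistFunctor_comp, inv_mul_cancel, twistFunctor_one]
  additive := ⟨fun {_ _ _ _} => smul_add _ _ _⟩
  linear := ⟨fun {x y} f c => smul_comm ((m x * (m y)⁻¹ : kˣ) : k) c f⟩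

theorem twist_mul (m m' : C → kˣ) : twist (C := C) m * twist m' = twist (m * m') := by
  apply ext_functor
  rw [mul_functor, mul_comm m m']
  exact twistFunctor_comp m' m

theorem twist_one : twist (C := C) (1 : C → kˣ) = 1 := ext_functor twistFunctor_one

/-- Moving a twist past g pulls its weights back along g. This is the source of the shifted argument
in the cocycle condition. -/
theorem twist_mul_comm (g : LinAut k C) (m : C → kˣ) :
    twist m * g = g * twist (fun x => m (g.functor.obj x)) := by
  apply ext_functor
  refine Functor.hext (fun _ => rfl) fun x y f => heq_of_eq ?_
  exact (g.functor.map_smul (R := k)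
    (r := ((m (g.functor.obj x) * (m (g.functor.obj y))⁻¹ : kˣ) : k)) f).symm

/-- The permutation of the objects given by an automorphism. -/
def objPerm (g : LinAut k C) : Equiv.Perm C where
  toFun := g.functor.obj
  invFun := g.inverse.obj
  left_inv := g.inverse_obj_functor_obj
  right_inv := g.functor_obj_inverse_obj

theorem objPerm_zpow (g : LinAut k C) (a : ℤ) (x : C) :
    (g.objPerm ^ a) x = (g ^ a).functor.obj x := by
  induction a generalizing x with
  | zero => rw [zpow_zero, zpow_zero]; rfl
  | succ a ih =>
    rw [add_comm, zpow_add, zpow_add, Equiv.Perm.mul_apply, ih, zpow_one, zpow_one]; rfl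
  | pred a ih =>
    rw [sub_eq_add_neg, add_comm, zpow_add, zpow_add, Equiv.Perm.mul_apply, ih, zpow_neg_one,
      zpow_neg_one]; rfl

/-- If `h` is a twist of `g`, the powers of `h` are the twists of the powers of `g` by a
cocycle. -/
theorem exists_zpow_eq_mul_twist {g h : LinAut k C} {m : C → kˣ} (e : h = g * twist m) :
    ∃ M : ℤ → C → kˣ, (∀ a, h ^ a = g ^ a * twist (M a)) ∧
      ∀ (a b : ℤ) (x : C), M (b + a) x = M a x * M b ((g ^ a).functor.obj x) := by
  obtain ⟨M, hM1, hM⟩ := exists_int_cocycle g.objPerm m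
  simp only [objPerm_zpow] at hM
  have hM0 : M 0 = 1 := by
    ext1 x
    have h1 := hM 0 0 x
    rw [add_zero, zpow_zero_obj] at h1
    exact mul_eq_left.1 h1.symm
  -- The cocycle condition says that a ↦ g ^ a * twist (M a) is multiplicative, so it suffices to
  -- compare it with h ^ a at a = 1.
  have hadd : ∀ a b : ℤ, g ^ (b + a) * twist (M (b + a)) =
      g ^ b * twist (M b) * (g ^ a * twist (M a)) := fun a b => by
    rw [mul_assoc, ← mul_assoc (twist (M b)), twist_mul_comm, mul_assoc, twist_mul, ← mul_assoc,
      zpow_add]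
    congr 2
    ext1 x
    rw [hM a b x, mul_comm]; rfl
  have h1 : h ^ (1 : ℤ) = g ^ (1 : ℤ) * twist (M 1) := by rw [zpow_one, zpow_one, hM1, e]
  have hneg : h ^ (-1 : ℤ) = g ^ (-1 : ℤ) * twist (M (-1)) := by
    rw [zpow_neg, h1]
    refine inv_eq_of_mul_eq_one_left ?_
    rw [← hadd, neg_add_cancel, hM0, twist_one, zpow_zero, mul_one]
  refine ⟨M, fun a => ?_, hM⟩
  induction a with
  | zero => rw [hM0, twist_one, zpow_zero, zpow_zero, mul_one]
  | succ a ih => rw [hadd, ← h1, ← ih, zpow_add]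
  | pred a ih => rw [sub_eq_add_neg, add_comm, hadd, ← hneg, ← ih, zpow_add]

/-- The canonical isomorphism between an automorphism and its twist. -/
def isoOfEqMulTwist {g h : LinAut k C} {m : C → kˣ} (e : h = g * twist m) :
    h.functor ≅ g.functor :=
  NatIso.ofComponents
    (fun x => { hom := (m x : k) • eqToHom (by rw [e]; rfl)
                inv := ((m x)⁻¹ : kˣ).val • eqToHom (by rw [e]; rfl)
                hom_inv_id := by simp [smul_smul]
                inv_hom_id := by simp [smul_smul] })
    (fun {x y} f => by
      subst e
      -- The twist factor m x / m y is exactly what the components m x and m y cancel in the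
      -- naturality square.
      change (g.functor.map (((m x * (m y)⁻¹ : kˣ) : k) • f)) ≫ ((m y : k) • 𝟙 (g.functor.obj y)) =
        ((m x : k) • 𝟙 (g.functor.obj x)) ≫ g.functor.map f
      rw [Functor.map_smul, Linear.smul_comp, Linear.comp_smul, Linear.smul_comp, smul_smul,
        ← Units.val_mul, inv_mul_cancel_right, Category.comp_id, Category.id_comp])

end LinAut

/-! ### Equivariant structures from cocycles of twists -/

namespace EquivariantStructure

variable {k : Type w} [Field k] {C : Type u} [Category.{v} C] [Preadditive C] [Linear k C]

/-- The equivariant structure on the identity functor given by a cocycle of twists. -/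
def ofTwist {g h : LinAut k C} (M : ℤ → C → kˣ)
    (hM : ∀ a, h ^ a = g ^ a * LinAut.twist (M a))
    (hadd : ∀ (a b : ℤ) (x : C), M (b + a) x = M a x * M b ((g ^ a).functor.obj x)) :
    EquivariantStructure g h (𝟭 C) where
  iso a := LinAut.isoOfEqMulTwist (hM a)
  iso_add a b x := by
    change (M (b + a) x : k) • eqToHom _ = _ ≫ (h ^ b).functor.map ((M a x : k) • eqToHom _) ≫
      ((M b ((g ^ a).functor.obj x) : k) • eqToHom _) ≫ _
    rw [Functor.map_smul, eqToHom_map, hadd]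
    simp [smul_smul, mul_comm]

theorem ofTwist_iso_hom_app {g h : LinAut k C} (M : ℤ → C → kˣ)
    (hM : ∀ a, h ^ a = g ^ a * LinAut.twist (M a))
    (hadd : ∀ (a b : ℤ) (x : C), M (b + a) x = M a x * M b ((g ^ a).functor.obj x))
    (a : ℤ) (x : C) : ((ofTwist M hM hadd).iso a).hom.app x =
      (M a x : k) • eqToHom (by rw [hM a]; rfl) := rfl

open DirectSum

/-- The functors on orbit categories given by mutually inverse cocycles are mutually inverse. -/
theorem orbitFunctor_ofTwist_map_map {g h : LinAut k C} (M M' : ℤ → C → kˣ) (hM hadd hM' hadd')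
    (hinv : ∀ a x, M' a x * M a x = 1) {x y : OrbitCat g} (u : x ⟶ y) :
    (ofTwist (g := h) (h := g) M' hM' hadd').orbitFunctor.map
      ((ofTwist (g := g) (h := h) M hM hadd).orbitFunctor.map u) = u := by
  change (ofTwist (g := h) (h := g) M' hM' hadd').orbitMap x.pt y.pt
    ((ofTwist (g := g) (h := h) M hM hadd).orbitMap x.pt y.pt u) = u
  obtain ⟨x⟩ := x
  obtain ⟨y⟩ := y
  change OrbitCat.HomSum g x y at u
  induction u using OrbitCat.hom_induction with
  | h0 => rw [map_zero, map_zero]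
  | hadd u v hu hv => rw [map_add, map_add, hu, hv]
  | hlof a u =>
    rw [orbitMap_lof]
    refine (orbitMap_lof _ _).trans ?_
    rw [ofTwist_iso_hom_app, ofTwist_iso_hom_app]
    congr 1
    change ((M' a x : k) • eqToHom _) ≫ ((M a x : k) • eqToHom _) ≫ u = u
    simp [smul_smul, ← Units.val_mul, mul_comm (M a x), hinv]

variable {D : Type u'} [Category.{v'} D] [Preadditive D] [Linear k D]

theorem isDegreePreserving_orbitFunctor {g : LinAut k C} {h : LinAut k D} {E : C ⥤ D}
    [E.Additive] [E.Linear k] (η : EquivariantStructure g h E) :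
    IsDegreePreserving (OrbitCat.grading g) (OrbitCat.grading h) η.orbitFunctor
      (fun _ => 0) where
  additive := ⟨fun {x y u u'} => map_add (η.orbitMap x.pt y.pt) u u'⟩
  linear := ⟨fun {x y} u c => map_smul (η.orbitMap x.pt y.pt) c u⟩
  map_mem {x y a f} hf := by
    rw [zero_add] at hf
    rw [add_zero]
    obtain ⟨u, rfl⟩ := hf
    exact ⟨_, (orbitMap_lof η u).symm⟩

end EquivariantStructure

/-! ### Graded isomorphisms of orbit categories -/

section Graded

variable {k : Type w} [Field k]

/-- The degree is written `-0 + 0` because this is the form that `IsDegreeMorphism` takes for zero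
adjusters. Identities in degree 0 are assumed since `LinGrading` has no field for them. -/
theorem LinGrading.eqToHom_mem {B : Type u} [Category.{v} B] [Preadditive B] [Linear k B]
    (𝓑 : LinGrading k B) (hid : ∀ x, 𝟙 x ∈ 𝓑.deg x x 0) {x y : B} (e : x = y) :
    eqToHom e ∈ 𝓑.deg x y (-0 + 0) := by
  subst e
  exact hid x

/-- An isomorphism of graded categories is an equivalence with degree adjuster `0`. -/
theorem IsGradedIso.isGradedEquivalence {B : Type u} [Category.{v} B] [Preadditive B] [Linear k B]
    {B' : Type u'} [Category.{v'} B'] [Preadditive B'] [Linear k B']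
    {𝓑 : LinGrading k B} {𝓑' : LinGrading k B'} {H : B ⥤ B'}
    (hid : ∀ x, 𝟙 x ∈ 𝓑.deg x x 0) (hid' : ∀ x, 𝟙 x ∈ 𝓑'.deg x x 0)
    (hH : IsGradedIso 𝓑 𝓑' H) : IsGradedEquivalence 𝓑 𝓑' H (fun _ => 0) := by
  obtain ⟨hH, I, hI, h1, h2⟩ := hH
  refine ⟨hH, I, fun _ => 0, eqToIso h1.symm, eqToIso h2, hI, fun x => ?_, fun x => ?_,
    fun x => ?_, fun x => ?_⟩
  · rw [eqToIso.hom, eqToHom_app]; exact LinGrading.eqToHom_mem 𝓑 hid _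
  · rw [eqToIso.inv, eqToHom_app]; exact LinGrading.eqToHom_mem 𝓑 hid _
  · rw [eqToIso.hom, eqToHom_app]; exact LinGrading.eqToHom_mem 𝓑' hid' _
  · rw [eqToIso.inv, eqToHom_app]; exact LinGrading.eqToHom_mem 𝓑' hid' _

theorem OrbitCat.id_mem_grading {C : Type u} [Category.{v} C] [Preadditive C] [Linear k C]
    (g : LinAut k C) (x : OrbitCat g) : 𝟙 x ∈ (OrbitCat.grading g).deg x x 0 :=
  ⟨eqToHom (g.zpow_zero_obj x.pt), rfl⟩

theorem FullOn.isDegreePreserving_restrict {J : Type u'} {B : Type u} [Category.{v} B]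
    [Preadditive B] [Linear k B] {B' : Type u} [Category.{v} B'] [Preadditive B'] [Linear k B']
    {𝓑 : LinGrading k B} {𝓑' : LinGrading k B'} {H : B ⥤ B'} (ι : J → B)
    (h : IsDegreePreserving 𝓑 𝓑' H (fun _ => 0)) :
    IsDegreePreserving (FullOn.grading 𝓑 ι) (FullOn.grading 𝓑' fun j => H.obj (ι j))
      (FullOn.restrict H ι) (fun _ => 0) where
  additive := ⟨fun {x y _ _} => h.additive.map_add (X := ι x.pt) (Y := ι y.pt)⟩
  linear := ⟨fun {x y} f c => h.linear.map_smul (X := ι x.pt) (Y := ι y.pt) f c⟩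
  map_mem {_ _ _ _} hf := h.map_mem hf

end Graded

open EquivariantStructure in
/-- If `h` is a twist of `g`, then the orbit categories of `g` and `h` are isomorphic as graded
categories, and so are their full subcategories on corresponding sets of objects. -/
theorem LinAut.exists_equivariantStructure_of_eq_mul_twist {k : Type w} [Field k] {C : Type u}
    [Category.{v} C] [Preadditive C] [Linear k C] {g h : LinAut k C} {m : C → kˣ}
    (e : h = g * LinAut.twist m) :
    ∃ η : EquivariantStructure g h (𝟭 C),
      IsGradedIso (OrbitCat.grading g) (OrbitCat.grading h) η.orbitFunctor ∧
      ∀ T : Set C, IsGradedIso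
        (FullOn.grading (OrbitCat.grading g) (fun t : T => (⟨t.1⟩ : OrbitCat g)))
        (FullOn.grading (OrbitCat.grading h) (fun t : T => (⟨t.1⟩ : OrbitCat h)))
        (FullOn.restrict η.orbitFunctor (fun t : T => (⟨t.1⟩ : OrbitCat g))) := by
  obtain ⟨M, hM, hadd⟩ := LinAut.exists_zpow_eq_mul_twist e
  have hM' : ∀ a, g ^ a = h ^ a * LinAut.twist (M⁻¹ a) := fun a => by
    rw [hM a, mul_assoc, LinAut.twist_mul, Pi.inv_apply, mul_inv_cancel, LinAut.twist_one, mul_one]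
  -- A twist fixes objects, so h ^ a and g ^ a agree on them and the inverse family is a cocycle for
  -- the action of h.
  have hadd' : ∀ (a b : ℤ) (x : C),
      M⁻¹ (b + a) x = M⁻¹ a x * M⁻¹ b ((h ^ a).functor.obj x) := fun a b x => by
    rw [hM a]
    simp only [Pi.inv_apply, hadd a b x, mul_inv]
    rfl
  let η := ofTwist M hM hadd
  let η' := ofTwist M⁻¹ hM' hadd'
  have h1 := fun {x y : OrbitCat g} (u : x ⟶ y) =>
    orbitFunctor_ofTwist_map_map M M⁻¹ hM hadd hM' hadd' (fun a x => inv_mul_cancel (M a x)) u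
  have h2 := fun {x y : OrbitCat h} (u : x ⟶ y) =>
    orbitFunctor_ofTwist_map_map M⁻¹ M hM' hadd' hM hadd (fun a x => mul_inv_cancel (M a x)) u
  refine ⟨η, ⟨η.isDegreePreserving_orbitFunctor, η'.orbitFunctor,
    η'.isDegreePreserving_orbitFunctor, ?_, ?_⟩, fun T =>
    ⟨FullOn.isDegreePreserving_restrict _ η.isDegreePreserving_orbitFunctor,
      FullOn.restrict η'.orbitFunctor (fun t : T => (⟨t.1⟩ : OrbitCat h)),
      FullOn.isDegreePreserving_restrict _ η'.isDegreePreserving_orbitFunctor, ?_, ?_⟩⟩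
  · exact Functor.hext (fun _ => rfl) fun _ _ u => heq_of_eq (h1 u)
  · exact Functor.hext (fun _ => rfl) fun _ _ u => heq_of_eq (h2 u)
  · exact Functor.hext (fun _ => rfl) fun x y u => heq_of_eq
      (h1 (x := ⟨x.pt.1⟩) (y := ⟨y.pt.1⟩) u)
  · exact Functor.hext (fun _ => rfl) fun x y u => heq_of_eq
      (h2 (x := ⟨x.pt.1⟩) (y := ⟨y.pt.1⟩) u)

/-! ### Automorphisms of the repetitive category that fix the objects -/

namespace LinAut

variable {k : Type w} [Field k] {C : Type u} [Category.{v} C] [Preadditive C] [Linear k C]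

/-- The action on morphism spaces of an automorphism that fixes the objects. -/
def fixMap (θ : LinAut k C) (h : ∀ x, θ.functor.obj x = x) {x y : C} (f : x ⟶ y) : x ⟶ y :=
  eqToHom (h x).symm ≫ θ.functor.map f ≫ eqToHom (h y)

variable (θ : LinAut k C) (h : ∀ x, θ.functor.obj x = x)

theorem map_eq_fixMap {x y : C} (f : x ⟶ y) :
    θ.functor.map f = eqToHom (h x) ≫ θ.fixMap h f ≫ eqToHom (h y).symm := by
  simp [fixMap]

theorem fixMap_id (x : C) : θ.fixMap h (𝟙 x) = 𝟙 x := by simp [fixMap]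

theorem fixMap_comp {x y z : C} (f : x ⟶ y) (g : y ⟶ z) :
    θ.fixMap h (f ≫ g) = θ.fixMap h f ≫ θ.fixMap h g := by simp [fixMap]

theorem fixMap_add {x y : C} (f g : x ⟶ y) :
    θ.fixMap h (f + g) = θ.fixMap h f + θ.fixMap h g := by
  simp [fixMap, Functor.map_add]

theorem fixMap_smul {x y : C} (c : k) (f : x ⟶ y) :
    θ.fixMap h (c • f) = c • θ.fixMap h f := by
  simp [fixMap, Functor.map_smul]

theorem fixMap_zero {x y : C} : θ.fixMap h (0 : x ⟶ y) = 0 := by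
  simp [fixMap]

theorem fixMap_ne_zero {x y : C} {f : x ⟶ y} (hf : f ≠ 0) : θ.fixMap h f ≠ 0 := by
  intro h0
  refine hf (θ.functor.map_injective ?_)
  rw [map_eq_fixMap θ h f, h0]
  simp

theorem eq_twist_of_fixMap (m : C → kˣ)
    (hm : ∀ {x y : C} (f : x ⟶ y), θ.fixMap h f = ((m x * (m y)⁻¹ : kˣ) : k) • f) :
    θ = twist m := by
  apply ext_functor
  refine CategoryTheory.Functor.ext h fun x y f => ?_
  rw [map_eq_fixMap θ h f, hm]
  rfl

end LinAut

namespace Repetitive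

variable {k : Type w} [Field k] {A : Type u} [Category.{v} A] [Preadditive A] [Linear k A]

/-- The morphism `y^[i] ⟶ x^[i+1]` given by an element of the dual bimodule. -/
def dualHom (i : ℤ) {x y : A} (β : Module.Dual k (x ⟶ y)) :
    (⟨y, i⟩ : Repetitive k A) ⟶ ⟨x, i + 1⟩ :=
  mkHom (p := ⟨y, i⟩) (q := ⟨x, i + 1⟩) 0 β (fun _ => rfl) (fun h => absurd rfl h)

/-- The morphism `x^[i] ⟶ y^[i]` given by a morphism of `A`. -/
def levelHom (i : ℤ) {x y : A} (f : x ⟶ y) : (⟨x, i⟩ : Repetitive k A) ⟶ ⟨y, i⟩ :=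
  (level k A i).map f

theorem levelHom_comp_dualHom (i : ℤ) {x y : A} (f : x ⟶ y) (β : Module.Dual k (x ⟶ y)) :
    levelHom i f ≫ dualHom i β = dualHom i (dualRight f β) := by
  refine hom_ext ?_ ?_
  · exact Limits.comp_zero
  · change dualRight f β + dualLeft (0 : Module.Dual k (y ⟶ x)) (0 : y ⟶ x) = dualRight f β
    ext; simp

theorem dualHom_comp_levelHom (i : ℤ) {x y : A} (β : Module.Dual k (x ⟶ y)) (f : x ⟶ y) :
    dualHom i β ≫ levelHom (i + 1) f = dualHom i (dualLeft β f) := by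
  refine hom_ext ?_ ?_
  · exact Limits.zero_comp
  · change dualRight (0 : y ⟶ x) (0 : Module.Dual k (y ⟶ x)) + dualLeft β f = dualLeft β f
    ext; simp

theorem eq_dualHom (i : ℤ) {x y : A} (a : (⟨y, i⟩ : Repetitive k A) ⟶ ⟨x, i + 1⟩) :
    a = dualHom i (homSnd a) :=
  hom_ext (homFst_eq_zero a (by simp)) rfl

theorem eq_levelHom (i : ℤ) {x y : A} (a : (⟨x, i⟩ : Repetitive k A) ⟶ ⟨y, i⟩) :
    a = levelHom i (homFst a) :=
  hom_ext rfl (homSnd_eq_zero a (by simp))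

theorem dualHom_smul (i : ℤ) {x y : A} (c : k) (β : Module.Dual k (x ⟶ y)) :
    dualHom i (c • β) = c • dualHom i β := by
  refine hom_ext ?_ rfl
  exact (smul_zero (A := (y ⟶ x)) c).symm

theorem dualHom_injective (i : ℤ) {x y : A} {β γ : Module.Dual k (x ⟶ y)}
    (h : dualHom i β = dualHom i γ) : β = γ := congrArg homSnd h

theorem levelHom_smul (i : ℤ) {x y : A} (c : k) (f : x ⟶ y) :
    levelHom (k := k) i (c • f) = c • levelHom i f := by
  refine hom_ext rfl ?_
  exact (smul_zero (A := Module.Dual k (y ⟶ x)) c).symm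

theorem levelHom_add (i : ℤ) {x y : A} (f g : x ⟶ y) :
    levelHom (k := k) i (f + g) = levelHom i f + levelHom i g := by
  refine hom_ext rfl ?_
  exact (add_zero (0 : Module.Dual k (y ⟶ x))).symm

theorem id_ne_zero (hc : HasNoNonzeroOrientedCycles k A) (x : A) : 𝟙 x ≠ 0 := by
  obtain ⟨e⟩ := hc x
  intro h0
  have h1 : e (1 : End x) = e 0 := congrArg e h0
  rw [map_one, map_zero] at h1
  exact one_ne_zero h1

theorem exists_dual_id (hc : HasNoNonzeroOrientedCycles k A) (x : A) :
    ∃ ε : Module.Dual k (x ⟶ x), ε (𝟙 x) = 1 := by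
  obtain ⟨β, hβ⟩ : ∃ β : Module.Dual k (x ⟶ x), β (𝟙 x) ≠ 0 := by
    by_contra! h
    exact id_ne_zero hc x ((Module.forall_dual_apply_eq_zero_iff k _).1 h)
  exact ⟨(β (𝟙 x))⁻¹ • β, by simp [hβ]⟩

/-- Every endomorphism of x is a multiple of the identity, so a functional on them is determined by
its value there. -/
theorem dual_end_eq_smul (hc : HasNoNonzeroOrientedCycles k A) {x : A}
    {ε : Module.Dual k (x ⟶ x)} (hε : ε (𝟙 x) = 1) (γ : Module.Dual k (x ⟶ x)) :
    γ = γ (𝟙 x) • ε := by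
  ext f
  obtain ⟨t, rfl⟩ := exists_smul_id hc f
  simp [hε, mul_comm]

/-- The bimodule product lands in the line spanned by ε, and its coordinate is the evaluation
pairing. This turns compatibility with composition into an identity of scalars. -/
theorem dualRight_eq_smul (hc : HasNoNonzeroOrientedCycles k A) {x y : A}
    {ε : Module.Dual k (x ⟶ x)} (hε : ε (𝟙 x) = 1) (f : x ⟶ y) (β : Module.Dual k (x ⟶ y)) :
    dualRight f β = β f • ε := by
  rw [dual_end_eq_smul hc hε (dualRight f β)]; simp

theorem dualLeft_eq_smul (hc : HasNoNonzeroOrientedCycles k A) {x y : A}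
    {ε : Module.Dual k (y ⟶ y)} (hε : ε (𝟙 y) = 1) (β : Module.Dual k (x ⟶ y)) (f : x ⟶ y) :
    dualLeft β f = β f • ε := by
  rw [dual_end_eq_smul hc hε (dualLeft β f)]; simp

/-- Functionals on a vector space separate points: this half of nondegeneracy recovers the action on
A from the action on its dual. -/
theorem eq_of_forall_dual_eq {x y : A} {f g : x ⟶ y}
    (hfg : ∀ β : Module.Dual k (x ⟶ y), β f = β g) : f = g := by
  rw [← sub_eq_zero, ← Module.forall_dual_apply_eq_zero_iff k]
  intro β
  rw [map_sub, hfg, sub_self]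

section

variable (θ : LinAut k (Repetitive k A)) (h : ∀ p, θ.functor.obj p = p)

/-- The action of `θ` on the `i`-th copy of `A`. -/
def levelAction (i : ℤ) {x y : A} (f : x ⟶ y) : x ⟶ y :=
  homFst (θ.fixMap h (levelHom i f))

/-- The action of `θ` on the `i`-th copy of the dual bimodule. -/
def dualAction (i : ℤ) {x y : A} (β : Module.Dual k (x ⟶ y)) : Module.Dual k (x ⟶ y) :=
  homSnd (θ.fixMap h (dualHom i β))

theorem fixMap_levelHom (i : ℤ) {x y : A} (f : x ⟶ y) :
    θ.fixMap h (levelHom i f) = levelHom i (levelAction θ h i f) :=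
  eq_levelHom i _

theorem fixMap_dualHom (i : ℤ) {x y : A} (β : Module.Dual k (x ⟶ y)) :
    θ.fixMap h (dualHom i β) = dualHom i (dualAction θ h i β) :=
  eq_dualHom i _

/-- `θ` acts on the one-dimensional spaces `Â(x^[i], x^[i+1])` by scalars, and these control the
pairing between the actions on `A` and on the dual bimodule. -/
theorem exists_dualAction_scalars (hc : HasNoNonzeroOrientedCycles k A) :
    ∃ ρ : ℤ → A → kˣ, ∀ (i : ℤ) {x y : A} (β : Module.Dual k (x ⟶ y)) (f : x ⟶ y),
      dualAction θ h i β (levelAction θ h i f) = ρ i x * β f ∧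
      dualAction θ h i β (levelAction θ h (i + 1) f) = ρ i y * β f := by
  choose ε hε using exists_dual_id hc
  -- The scalar of θ on the line Â(x^[i], x^[i+1]) is read off at the identity; it is nonzero
  -- because θ is faithful.
  have hne : ∀ (i : ℤ) (x : A), dualAction θ h i (ε x) (𝟙 x) ≠ 0 := by
    intro i x h0
    have h1 : dualHom i (ε x) ≠ 0 := fun h0 => by
      have h2 : ε x = 0 := congrArg homSnd h0
      have h3 := hε x
      rw [h2] at h3
      exact zero_ne_one h3
    refine θ.fixMap_ne_zero h h1 ?_
    rw [fixMap_dualHom, dual_end_eq_smul hc (hε x) (dualAction θ h i (ε x)), h0, dualHom_smul,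
      zero_smul]
  have hact : ∀ (i : ℤ) (x : A) (c : k), θ.fixMap h (dualHom i (c • ε x)) =
      dualHom i ((dualAction θ h i (ε x) (𝟙 x) * c) • ε x) := fun i x c => by
    rw [dualHom_smul, LinAut.fixMap_smul, fixMap_dualHom,
      dual_end_eq_smul hc (hε x) (dualAction θ h i (ε x)), ← dualHom_smul, smul_smul]
    simp [hε, mul_comm]
  refine ⟨fun i x => Units.mk0 _ (hne i x), fun i {x y} β f => ⟨?_, ?_⟩⟩
  -- θ is applied to the composite x^[i] ⟶ y^[i] ⟶ x^[i+1], which lies in the line at x.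
  · have h1 := congrArg (θ.fixMap h) (levelHom_comp_dualHom i f β)
    rw [LinAut.fixMap_comp, fixMap_levelHom, fixMap_dualHom, levelHom_comp_dualHom,
      dualRight_eq_smul hc (hε x), dualRight_eq_smul hc (hε x), hact] at h1
    have h2 := congrArg (fun γ : Module.Dual k (x ⟶ x) => γ (𝟙 x)) (dualHom_injective i h1)
    simpa [hε] using h2
  -- In the other order the composite is y^[i] ⟶ x^[i+1] ⟶ y^[i+1]: here f sits at level i + 1 and
  -- the line is the one at y.
  · have h1 := congrArg (θ.fixMap h) (dualHom_comp_levelHom i β f)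
    rw [LinAut.fixMap_comp, fixMap_levelHom, fixMap_dualHom, dualHom_comp_levelHom,
      dualLeft_eq_smul hc (hε y), dualLeft_eq_smul hc (hε y), hact] at h1
    have h2 := congrArg (fun γ : Module.Dual k (y ⟶ y) => γ (𝟙 y)) (dualHom_injective i h1)
    simpa [hε] using h2

/-- If an automorphism of `Â` fixes the objects and acts on one copy of `A` by a twist, then it is
a twist. -/
theorem exists_eq_twist (hc : HasNoNonzeroOrientedCycles k A) (j : ℤ) (l : A → kˣ)
    (hl : ∀ {x y : A} (f : x ⟶ y), levelAction θ h j f = ((l x * (l y)⁻¹ : kˣ) : k) • f) :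
    ∃ m : Repetitive k A → kˣ, θ = LinAut.twist m := by
  obtain ⟨ρ, hρ⟩ := exists_dualAction_scalars θ h hc
  obtain ⟨M, hM1, hM⟩ := exists_int_cocycle (Equiv.addRight (1 : ℤ)) fun i x => (ρ i x)⁻¹
  -- A twist by L scales the line at x^[i] by L i x / L (i + 1) x, which must equal ρ i x. The
  -- two-sided recursion is solved by a cocycle for translation by 1 on ℤ, with values in functions
  -- A → kˣ.
  obtain ⟨L, hL0, hL⟩ : ∃ L : ℤ → A → kˣ, L j = l ∧ ∀ i x, L (i + 1) x = L i x * (ρ i x)⁻¹ := by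
    have hM0 : M 0 j = 1 := by
      have h1 := hM 0 0 j
      rw [add_zero, zpow_zero, Equiv.Perm.one_apply] at h1
      exact mul_eq_left.1 h1.symm
    have hpow : ∀ a : ℤ, (Equiv.addRight (1 : ℤ) ^ a) j = j + a := fun a => by
      rw [Equiv.zsmul_addRight]; simp
    refine ⟨fun i => l * M (i - j) j, by simp [hM0], fun i x => ?_⟩
    dsimp only
    rw [show i + 1 - j = 1 + (i - j) by ring, hM, hM1, ← mul_assoc, hpow]
    simp [mul_assoc]
  have hLk : ∀ i x, (L (i + 1) x : k) = L i x * (ρ i x : k)⁻¹ := fun i x => by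
    rw [hL]; simp
  let Q : ℤ → Prop := fun i => ∀ {x y : A} (f : x ⟶ y),
    levelAction θ h i f = ((L i x * (L i y)⁻¹ : kˣ) : k) • f
  -- An element of D A(x, y) is a morphism y^[i] ⟶ x^[i+1], hence the swapped objects in the scalar.
  let R : ℤ → Prop := fun i => ∀ {x y : A} (β : Module.Dual k (x ⟶ y)),
    dualAction θ h i β = ((L i y * (L (i + 1) x)⁻¹ : kˣ) : k) • β
  have hQR : ∀ i, Q i → R i := fun i hQ {x y} β => by
    ext f
    have h1 := (hρ i β f).1
    rw [hQ, map_smul, smul_eq_mul] at h1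
    rw [LinearMap.smul_apply, smul_eq_mul]
    simp only [Units.val_mul, Units.val_inv_eq_inv_val, hLk] at h1 ⊢
    field_simp at h1 ⊢
    linear_combination h1
  have hQR' : ∀ i, Q (i + 1) → R i := fun i hQ {x y} β => by
    ext f
    have h1 := (hρ i β f).2
    rw [hQ, map_smul, smul_eq_mul] at h1
    rw [LinearMap.smul_apply, smul_eq_mul]
    simp only [Units.val_mul, Units.val_inv_eq_inv_val, hLk] at h1 ⊢
    field_simp at h1 ⊢
    linear_combination h1
  -- The copy at level i fixes the action on the dual bimodule above it, which by the pairing with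
  -- level i + 1 fixes that copy; `hdown` runs this in reverse.
  have hup : ∀ i, Q i → Q (i + 1) := fun i hQ {x y} f => by
    refine eq_of_forall_dual_eq (k := k) fun β => ?_
    have h1 := (hρ i β f).2
    rw [hQR i hQ, LinearMap.smul_apply, smul_eq_mul] at h1
    rw [map_smul, smul_eq_mul]
    simp only [Units.val_mul, Units.val_inv_eq_inv_val, hLk] at h1 ⊢
    field_simp at h1 ⊢
    linear_combination h1
  have hdown : ∀ i, Q (i + 1) → Q i := fun i hQ {x y} f => by
    refine eq_of_forall_dual_eq (k := k) fun β => ?_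
    have h1 := (hρ i β f).1
    rw [hQR' i hQ, LinearMap.smul_apply, smul_eq_mul] at h1
    rw [map_smul, smul_eq_mul]
    simp only [Units.val_mul, Units.val_inv_eq_inv_val, hLk] at h1 ⊢
    field_simp at h1 ⊢
    linear_combination h1
  have hQ : ∀ i, Q i := fun i => by
    induction i using Int.inductionOn' (b := j) with
    | zero => intro x y f; rw [hL0]; exact hl f
    | succ i _ ih => exact hup i ih
    | pred i _ ih => exact hdown (i - 1) (by rwa [sub_add_cancel])
  refine ⟨fun p => L p.idx p.obj, θ.eq_twist_of_fixMap h _ fun {p q} a => ?_⟩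
  obtain ⟨x, i⟩ := p
  obtain ⟨y, i'⟩ := q
  by_cases h1 : i' = i
  · subst h1
    rw [eq_levelHom i' a, fixMap_levelHom, hQ, levelHom_smul]
  · by_cases h2 : i' = i + 1
    · subst h2
      rw [eq_dualHom i a, fixMap_dualHom, hQR i (hQ i), dualHom_smul]
    · have ha : a = 0 := hom_ext (homFst_eq_zero a h1) (homSnd_eq_zero a h2)
      rw [ha, LinAut.fixMap_zero, smul_zero]

end

end Repetitive

/-! ### From the induced automorphism of A and a quiver presentation to a twist on one copy -/

namespace Repetitive

variable {k : Type w} [Field k] {A : Type u} [Category.{v} A] [Preadditive A] [Linear k A]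

theorem level_comp_nakayama_zpow (i n : ℤ) :
    level k A i ⋙ (nakayama k A ^ n).functor = level k A (i + n) := by
  have h1 : ∀ j : ℤ, level k A j ⋙ (nakayama k A).functor = level k A (j + 1) := fun j => rfl
  have h2 : ∀ j : ℤ, level k A j ⋙ (nakayama k A)⁻¹.functor = level k A (j + -1) := fun j => rfl
  induction n with
  | zero => rw [zpow_zero, add_zero]; rfl
  | succ n ih =>
    rw [add_comm (n : ℤ) 1, LinAut.zpow_add_functor, ← Functor.assoc, ih, zpow_one, h1]
    congr 1; ring
  | pred n ih =>
    rw [sub_eq_add_neg, add_comm (-(n : ℤ)) (-1), LinAut.zpow_add_functor, ← Functor.assoc, ih,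
      zpow_neg_one, h2]
    congr 1; ring

/-- `φ₀⁻¹ ψ₀` is the automorphism that `φ⁻¹ ψ` induces on `A^[-n]`. -/
theorem zerothPart_inv_mul_comp_level (hA : IsLocallyBounded k A)
    (hc : HasNoNonzeroOrientedCycles k A) (φ ψ : LinAut k (Repetitive k A)) {n : ℤ}
    (hφ : HasJump φ n) (hψ : HasJump ψ n) :
    ((zerothPart hA hc φ hφ)⁻¹ * zerothPart hA hc ψ hψ).functor ⋙ level k A (-n) =
      level k A (-n) ⋙ (φ⁻¹ * ψ).functor := by
  set Φ := φ * nakayama k A ^ (-n)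
  set Ψ := ψ * nakayama k A ^ (-n)
  have h1 := restrictZero_comp_level Ψ (hψ.mul_nakayama_zpow hA hc)
  have h2 := restrictZero_comp_level Φ⁻¹ (hφ.mul_nakayama_zpow hA hc).inv_zero
  have h3 : ((zerothPart hA hc φ hφ)⁻¹ * zerothPart hA hc ψ hψ).functor ⋙ level k A 0 =
      level k A 0 ⋙ (Φ⁻¹ * Ψ).functor := by
    -- The inverse of the restriction of Φ is, by definition, the restriction of Φ⁻¹.
    change (restrictZero Ψ _).functor ⋙
      (restrictZero Φ⁻¹ (hφ.mul_nakayama_zpow hA hc).inv_zero).functor ⋙ level k A 0 = _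
    rw [h2, ← Functor.assoc, h1]
    rfl
  have h4 : level k A (-n) = level k A 0 ⋙ (nakayama k A ^ (-n)).functor := by
    rw [level_comp_nakayama_zpow, zero_add]
  -- Φ⁻¹Ψ is the conjugate ν^n (φ⁻¹ψ) ν^(-n), so its action on level 0 is that of φ⁻¹ψ on level -n.
  have h5 : nakayama k A ^ (-n) * (Φ⁻¹ * Ψ) = φ⁻¹ * ψ * nakayama k A ^ (-n) := by
    simp only [Φ, Ψ]; group
  rw [h4, ← Functor.assoc, h3, Functor.assoc, Functor.assoc, ← LinAut.mul_functor, h5]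
  rfl

section

variable (θ : LinAut k (Repetitive k A)) (h : ∀ p, θ.functor.obj p = p)

theorem levelAction_id (i : ℤ) (x : A) : levelAction θ h i (𝟙 x) = 𝟙 x := by
  have h1 : levelHom (k := k) i (𝟙 x) = 𝟙 _ := (level k A i).map_id x
  rw [levelAction, h1, LinAut.fixMap_id]; rfl

theorem levelAction_comp (i : ℤ) {x y z : A} (f : x ⟶ y) (g : y ⟶ z) :
    levelAction θ h i (f ≫ g) = levelAction θ h i f ≫ levelAction θ h i g := by
  have h1 : levelHom (k := k) i (f ≫ g) = levelHom i f ≫ levelHom i g := (level k A i).map_comp f g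
  rw [levelAction, h1, LinAut.fixMap_comp]; rfl

theorem levelAction_add (i : ℤ) {x y : A} (f g : x ⟶ y) :
    levelAction θ h i (f + g) = levelAction θ h i f + levelAction θ h i g := by
  rw [levelAction, levelHom_add, LinAut.fixMap_add]; rfl

theorem levelAction_smul (i : ℤ) {x y : A} (c : k) (f : x ⟶ y) :
    levelAction θ h i (c • f) = c • levelAction θ h i f := by
  rw [levelAction, levelHom_smul, LinAut.fixMap_smul]; rfl

/-- Translates the scaling hypothesis, stated for an automorphism of A with object equalities, into
the transport-free action on a copy. -/
theorem levelAction_eq_of_scalesBy {E : LinAut k A} {i : ℤ}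
    (hE : E.functor ⋙ level k A i = level k A i ⋙ θ.functor) {x y : A} {f : x ⟶ y} {c : kˣ}
    (hf : E.ScalesBy f c) : levelAction θ h i f = (c : k) • f := by
  obtain ⟨hx, hy, hf⟩ := hf
  have h1 := Functor.congr_hom hE.symm f
  simp only [Functor.comp_map, hf, Functor.map_comp, eqToHom_map, Category.assoc, eqToHom_trans,
    eqToHom_trans_assoc] at h1
  have h2 : θ.functor.map (levelHom i f) =
      eqToHom (h _) ≫ levelHom i ((c : k) • f) ≫ eqToHom (h _).symm := h1
  rw [levelAction, LinAut.fixMap, h2, levelHom_smul]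
  simp
  rfl

/-- If an automorphism acts on the arrows of a presentation as the coboundary of a potential, then
so it does on all morphisms. -/
theorem levelAction_eq_of_arrow {V : Type u'} [Quiver.{v'} V] (Q : QuiverPresentation k V A)
    (i : ℤ) (l : V → kˣ)
    (hl : ∀ {x y : V} (α : x ⟶ y),
      levelAction θ h i (Q.arrow α) = ((l x * (l y)⁻¹ : kˣ) : k) • Q.arrow α)
    {x y : A} (f : x ⟶ y) :
    levelAction θ h i f =
      ((l (Q.vertex.symm x) * (l (Q.vertex.symm y))⁻¹ : kˣ) : k) • f := by
  obtain ⟨x, rfl⟩ := Q.vertex.surjective x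
  obtain ⟨y, rfl⟩ := Q.vertex.surjective y
  rw [Equiv.symm_apply_apply, Equiv.symm_apply_apply]
  have hpath : ∀ {y : V} (p : Quiver.Path x y),
      levelAction θ h i (evalPath Q.vertex Q.arrow p) =
        ((l x * (l y)⁻¹ : kˣ) : k) • evalPath Q.vertex Q.arrow p := by
    intro y p
    induction p with
    | nil => rw [evalPath, levelAction_id]; simp
    | cons p α ih =>
      rw [evalPath, levelAction_comp, ih, hl, Linear.smul_comp, Linear.comp_smul, smul_smul,
        ← Units.val_mul]
      congr 2
      rw [mul_assoc, inv_mul_cancel_left]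
  -- Along a path the potential telescopes, so the scalar depends only on the endpoints and is
  -- common to all paths in a linear combination.
  obtain ⟨r, rfl⟩ := Q.surjective x y f
  induction r using Finsupp.induction_linear with
  | zero =>
    have h0 := levelAction_smul θ h i (0 : k) (0 : Q.vertex x ⟶ Q.vertex y)
    rw [map_zero, smul_zero]
    simpa using h0
  | add r s hr hs => rw [map_add, levelAction_add, hr, hs, smul_add]
  | single p c =>
    rw [Finsupp.linearCombination_single, levelAction_smul, hpath, smul_comm]

end

end Repetitive

/-! ### The main theorem -/

theorem theorem4p4 {k : Type w} [Field k] [IsAlgClosed k]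
    {A : Type u} [Category.{v} A] [Preadditive A] [Linear k A]
    (hA : IsBasicConnectedAlgebra k A) (hA' : HasNoNonzeroOrientedCycles k A)
    {V : Type u'} [Quiver.{v'} V] (Q : QuiverPresentation k V A)
    (φ ψ : LinAut k (Repetitive k A)) (n : ℤ)
    (hφ : Repetitive.HasJump φ n) (hψ : Repetitive.HasJump ψ n)
    (hobj : ∀ p : Repetitive k A, φ.functor.obj p = ψ.functor.obj p)
    (S : Set (ClosedWalk V)) (hS : ClosedWalk.IsCompleteRepresentatives S)
    (c : ∀ {x y : V}, (x ⟶ y) → kˣ)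
    (hc : ∀ {x y : V} (α : x ⟶ y),
      ((Repetitive.zerothPart hA.toIsLocallyBounded hA' φ hφ)⁻¹ *
        Repetitive.zerothPart hA.toIsLocallyBounded hA' ψ hψ).ScalesBy (Q.arrow α) (c α))
    (hcyc : ∀ Z ∈ S, ClosedWalk.scalar c Z = 1) :
    ∃ η : EquivariantStructure φ ψ (𝟭 (Repetitive k A)),
      IsGradedEquivalence (OrbitCat.grading φ) (OrbitCat.grading ψ) η.orbitFunctor (fun _ => 0) ∧
      (n ≠ 0 →
        IsGradedIso (OrbitCat.grading φ) (OrbitCat.grading ψ) η.orbitFunctor ∧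
        ∀ T : Set (Repetitive k A), IsOrbitTransversal φ T →
          IsOrbitTransversal ψ T ∧
          IsGradedIso
            (FullOn.grading (OrbitCat.grading φ) (fun t : T => (⟨t.1⟩ : OrbitCat φ)))
            (FullOn.grading (OrbitCat.grading ψ) (fun t : T => (⟨t.1⟩ : OrbitCat ψ)))
            (FullOn.restrict η.orbitFunctor (fun t : T => (⟨t.1⟩ : OrbitCat φ)))) := by
  obtain ⟨l, hl⟩ := ClosedWalk.exists_potential (V := V) c
    (ClosedWalk.scalar_eq_one_of_isSimple c fun C hC => hC.scalar_eq_one hS c hcyc)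
  have hfix : ∀ p, (φ⁻¹ * ψ).functor.obj p = p := fun p => by
    change φ.inverse.obj (ψ.functor.obj p) = p
    rw [← hobj, φ.inverse_obj_functor_obj]
  -- The starting level is -n, where the hypothesis on arrows is visible. The potential is inverted
  -- because a twist divides source by target, while c α is target over source.
  obtain ⟨m, hm⟩ := Repetitive.exists_eq_twist (φ⁻¹ * ψ) hfix hA' (-n)
    (fun x => (l (Q.vertex.symm x))⁻¹)
    (Repetitive.levelAction_eq_of_arrow _ hfix Q (-n) (fun x => (l x)⁻¹) fun {x y} α => by
      rw [inv_inv, ← hl α]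
      exact Repetitive.levelAction_eq_of_scalesBy _ hfix
        (Repetitive.zerothPart_inv_mul_comp_level _ hA' φ ψ hφ hψ) (hc α))
  have e : ψ = φ * LinAut.twist m := by rw [← hm, mul_inv_cancel_left]
  obtain ⟨η, h1, h2⟩ := LinAut.exists_equivariantStructure_of_eq_mul_twist e
  refine ⟨η, h1.isGradedEquivalence (OrbitCat.id_mem_grading φ) (OrbitCat.id_mem_grading ψ),
    fun _ => ⟨h1, fun T hT => ⟨fun x => ?_, h2 T⟩⟩⟩
  -- φ and ψ induce the same permutation of objects, so their orbits, and hence their transversals,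
  -- coincide.
  have hpow : ∀ (a : ℤ) (p : Repetitive k A),
      (ψ ^ a).functor.obj p = (φ ^ a).functor.obj p := fun a p => by
    rw [← LinAut.objPerm_zpow, ← LinAut.objPerm_zpow]
    congr 2
    ext1 q
    exact (hobj q).symm
  simpa only [hpow] using hT x
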